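/- Let $0<m<1$, $\alpha>\frac1{1-m}$, $\beta>1$, $r>0$ satisfy $m+\frac2\alpha\le\beta<2-m$, and consider the profile equation $$-\frac1{\beta-1}\Big(\varphi(z)+\frac{\beta-m}{2}\,z\,\varphi'(z)\Big)=(\varphi^m)''(z)+r\varphi^\beta(z).\qquad (E)$$ There are constants $z_0>0$, $C_0>0$, $C_\infty>0$, where $$C_0=\Big(\frac{z_0(\beta-m)}{2r(\beta-1)^2}\Big)^{\frac1{\beta-1}}$$ and $C_\infty$ is the constant for which $z\mapsto C_\infty z^{-2/(1-m)}$ solves $(E)$ with $r$ replaced by $0$ on $(0,+\infty)$ (so that $C_\infty$ depends only on $m$), and a function $\varepsilon:(0,+\infty)\to(0,+\infty)$, such that the following holds. For all $0<k_0<C_0<K_0$ and $0<k_\infty<C_\infty$ there are some $K_\infty>C_\infty$ and a (strictly) decreasing function $\varphi:(z_0,+\infty)\to(0,+\infty)$ of class $C^2$ that solves $(E)$ on $(z_0,+\infty)$ and satisfies: 1. (Blow-up zone.) There is $z_1>z_0$ such that, for all $z\in(z_0,z_1)$, $$\frac{k_0}{(z-z_0)^{\frac1{\beta-1}}}\le\varphi(z)\le\frac{K_0}{(z-z_0)^{\frac1{\beta-1}}},\qquad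 -\frac{k_0^{1-\beta}}{\beta-1}\varphi^\beta(z)<\varphi'(z)<-\frac{K_0^{1-\beta}}{\beta-1}\varphi^\beta(z).$$ 2. For every $\delta>0$, if $\max(K_0-C_0,\,C_0-k_0)<\varepsilon(\delta)$, then there is $z_1>z_0$ such that $|\varphi''(z)|\le\delta\,\varphi^{\beta+1-m}(z)$ for all $z\in(z_0,z_1)$. 3. (Tail.) For all sufficiently large $z$, $$\frac{k_\infty}{z^{\frac2{1-m}}}\le\varphi(z)\le\frac{K_\infty}{z^{\frac2{1-m}}}.$$ 4. For every $z_1>z_0$ there are $K'>0$ and $K''>0$ such that, for all $z\ge z_1$, $$-K'\varphi^{\frac{3-m}2}(z)\le\varphi'(z)<0,\qquad |\varphi''(z)|\le K''\varphi^{2-m}(z).$$ -/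

import Mathlib

open Set Filter

/-- `φ` is a positive classical (`C²`) solution on `I` of the profile equation
`-(φ + ((β - m) / 2) z φ') / (β - 1) = (φ ^ m)'' + r φ ^ β`. The set `I` is meant to be an open
interval, so that `deriv` is the genuine derivative there. -/
def IsProfileSolutionOn (m β r : ℝ) (φ : ℝ → ℝ) (I : Set ℝ) : Prop :=
  ContDiffOn ℝ 2 φ I ∧ (∀ z ∈ I, 0 < φ z) ∧
    ∀ z ∈ I, -(1 / (β - 1)) * (φ z + (β - m) / 2 * z * deriv φ z)
      = deriv (deriv fun y => φ y ^ m) z + r * φ z ^ β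

/-!
The profile is found through the unknown `p = φ ^ (1 - β)`, which vanishes at the blow-up point `z₀`
and increases to `+∞`, taken as the independent variable. With `σ = (1 - m) / (β - 1) > 1`,
`ρ = r (β - 1)` and `A ^ 2 = 2 m (1 + m) / (1 - m) = C_inf ^ (1 - m)`, write the similarity variable
as `z = A * V(p) ^ (σ / 2)`. The profile equation becomes `V'' = profileField σ μ ρ p V V'` on the
fixed half-line `p > 0`, the unknown `z₀` being now encoded in the value `V(0+)`. When `ρ = 0` the pure
power `C_inf / z ^ (2 / (1 - m))` is the solution `V = p`.

The point of this choice is that half-lines `V = p + b` are barriers. For `b = lo = ρ / 2` the field is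
negative along the half-line with slope `1`, for `b = hi = ρ σ / (σ - 1)` it is positive
(`profileField_lower`, `profileField_upper`). Hence an orbit that crosses the lower half-line
downwards, or the upper one upwards, never comes back, and an intermediate value argument on the
initial value gives, for `0 < ε < N`, an orbit with `p + lo ≤ V ≤ p + hi` on `[ε, N]`
(`IsTrapping.exists_trapped`). The slope of such an orbit stays between positive constants, so
that a subsequence converges as `ε → 0`, `N → ∞` (`IsTrapping.exists_global`).

Near `p = 0` the equation is stiff: a slope `v = V'` different from the value
`(σ + 1) V(0+) / (σ ρ)`, which cancels the dominant term, would be driven out of its bounds as `p`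
decreases to `0` (`profileField_stiff`). So `V'` has that limit, which determines `C₀`, and near `z₀`
the term `(φ ^ m)''` is negligible. The inequality `p ≤ V ≤ p + hi` is the tail estimate, and the
derivative bounds follow from the bounds on `V'` and the equation itself
(`exists_isPressureProfile` and the lemmas in the namespace `IsPressureProfile`).
-/

/-! ### Forward invariance and a clamped flow -/

open Topology in
/-- A forward-invariance principle for a quadrant. While `w ≤ 0` the function `D` does not
increase, and `w` cannot leave `w ≤ 0` because its derivative is negative whenever `w = 0` and
`D ≤ 0`. -/
lemma quadrant_forward_invariant {a b : ℝ} {D w D' w' : ℝ → ℝ}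
    (hD : ∀ t ∈ Icc a b, HasDerivWithinAt D (D' t) (Icc a b) t)
    (hw : ∀ t ∈ Icc a b, HasDerivWithinAt w (w' t) (Icc a b) t)
    (h1 : ∀ t ∈ Icc a b, w t ≤ 0 → D' t ≤ 0)
    (h2 : ∀ t ∈ Icc a b, D t ≤ 0 → w t = 0 → w' t < 0)
    (hDa : D a ≤ 0) (hwa : w a ≤ 0) :
    ∀ t ∈ Icc a b, D t ≤ 0 ∧ w t ≤ 0 := by
  have hDc : ContinuousOn D (Icc a b) := fun t ht => (hD t ht).continuousWithinAt
  have hwc : ContinuousOn w (Icc a b) := fun t ht => (hw t ht).continuousWithinAt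
  have hcl : IsClosed ({t | D t ≤ 0 ∧ w t ≤ 0} ∩ Icc a b) := by
    have := (hDc.preimage_isClosed_of_isClosed isClosed_Icc (isClosed_Iic (a := (0 : ℝ)))).inter
      (hwc.preimage_isClosed_of_isClosed isClosed_Icc (isClosed_Iic (a := (0 : ℝ))))
    convert this using 1
    ext t
    simp only [mem_inter_iff, mem_ofPred_eq, mem_preimage, mem_Iic]
    tauto
  refine hcl.Icc_subset_of_forall_exists_gt ⟨hDa, hwa⟩ ?_
  rintro x ⟨⟨hDx, hwx⟩, hx⟩ y hy
  have hxI : x ∈ Icc a b := Ico_subset_Icc_self hx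
  have hsub : 𝓝[>] x ≤ 𝓝[Icc a b] x := by
    rw [← nhdsWithin_Ioc_eq_nhdsGT hx.2]
    exact nhdsWithin_mono _ (fun t ht => ⟨hx.1.trans ht.1.le, ht.2⟩)
  have hev : ∀ᶠ t in 𝓝[>] x, w t ≤ 0 := by
    rcases hwx.lt_or_eq with h | h
    · exact hsub (((hwc x hxI).eventually (gt_mem_nhds h)).mono fun _ => le_of_lt)
    · have hd : HasDerivWithinAt w (w' x) (Ioc x b) x :=
        (hw x hxI).mono (fun t ht => ⟨hx.1.trans ht.1.le, ht.2⟩)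
      rw [hasDerivWithinAt_iff_tendsto_slope' (by simp), nhdsWithin_Ioc_eq_nhdsGT hx.2] at hd
      filter_upwards [hd.eventually (gt_mem_nhds (h2 x hxI hDx h)), self_mem_nhdsWithin]
        with t ht hxt
      rw [slope_def_field, h, sub_zero] at ht
      have hpos : 0 < t - x := sub_pos.2 hxt
      by_contra hcon
      exact absurd ht (not_lt.2 (div_nonneg (not_le.1 hcon).le hpos.le))
  obtain ⟨c, hc, hcw⟩ := (mem_nhdsGT_iff_exists_Ioc_subset).1 hev
  have hxc : x < c := hc
  obtain ⟨e, hxe, hee⟩ : ∃ e, x < e ∧ e ≤ min c (min y b) :=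
    ⟨min c (min y b), lt_min hxc (lt_min hy hx.2), le_rfl⟩
  have hec : e ≤ c := hee.trans (min_le_left _ _)
  have hey : e ≤ y := hee.trans ((min_le_right _ _).trans (min_le_left _ _))
  have heb : e ≤ b := hee.trans ((min_le_right _ _).trans (min_le_right _ _))
  have hIcc : Icc x e ⊆ Icc a b := Icc_subset_Icc hx.1 heb
  have hanti : AntitoneOn D (Icc x e) := by
    refine antitoneOn_of_hasDerivWithinAt_nonpos (f' := D') (convex_Icc _ _) (hDc.mono hIcc) ?_ ?_
    · intro t ht
      rw [interior_Icc] at ht ⊢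
      exact (hD t (hIcc (Ioo_subset_Icc_self ht))).mono (Ioo_subset_Icc_self.trans hIcc)
    · intro t ht
      rw [interior_Icc] at ht
      exact h1 t (hIcc (Ioo_subset_Icc_self ht)) (hcw ⟨ht.1, ht.2.le.trans hec⟩)
  refine ⟨e, ⟨?_, hcw ⟨hxe, hec⟩⟩, hxe, hey⟩
  exact (hanti (left_mem_Icc.2 hxe.le) (right_mem_Icc.2 hxe.le) hxe.le).trans hDx

/-- The one-dimensional case of `quadrant_forward_invariant`. -/
lemma nonpos_forward_invariant {a b : ℝ} {w w' : ℝ → ℝ}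
    (hw : ∀ t ∈ Icc a b, HasDerivWithinAt w (w' t) (Icc a b) t)
    (h2 : ∀ t ∈ Icc a b, w t = 0 → w' t < 0) (hwa : w a ≤ 0) :
    ∀ t ∈ Icc a b, w t ≤ 0 := fun t ht =>
  (quadrant_forward_invariant (D := fun _ => 0) (D' := fun _ => 0)
    (fun _ _ => hasDerivWithinAt_const _ _ _) hw (fun _ _ _ => le_rfl)
    (fun t ht _ => h2 t ht) le_rfl hwa t ht).2

/-- The nearest-point projection of `ℝ` onto `[a, b]`. -/
def clamp (a b x : ℝ) : ℝ := max a (min b x)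

lemma clamp_mem {a b : ℝ} (h : a ≤ b) (x : ℝ) : clamp a b x ∈ Icc a b :=
  ⟨le_max_left _ _, max_le h (min_le_left _ _)⟩

lemma clamp_of_mem {a b x : ℝ} (h : x ∈ Icc a b) : clamp a b x = x := by
  rw [clamp, min_eq_right h.2, max_eq_right h.1]

lemma clamp_of_le {a b x : ℝ} (h : a ≤ b) (hx : x ≤ a) : clamp a b x = a := by
  rw [clamp, min_eq_right (hx.trans h), max_eq_left hx]

lemma clamp_of_ge {a b x : ℝ} (h : a ≤ b) (hx : b ≤ x) : clamp a b x = b := by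
  rw [clamp, min_eq_left hx, max_eq_right h]

lemma clamp_mono {a b x y : ℝ} (h : x ≤ y) : clamp a b x ≤ clamp a b y :=
  max_le_max le_rfl (min_le_min le_rfl h)

lemma lipschitzWith_clamp (a b : ℝ) : LipschitzWith 1 (clamp a b) := by
  have : LipschitzWith 1 fun x : ℝ => max a (min b x) :=
    (LipschitzWith.id.const_min b).const_max a
  exact this

/-- The planar system `U' = v - 1`, `v' = f p U v` together with the sign conditions that make the
box `[lo, hi] × [w₀, v₁]` trap an orbit: `f` points downwards at the corner `(lo, 1)`, upwards at
the corner `(hi, 1)`, inwards on the edge `v = v₁`, inwards on `v = 1 / 2` for `p ≤ p₁`, and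
outwards on the edge `v = w₀` for `p ≥ p₁`. -/
structure IsTrapping (f : ℝ → ℝ → ℝ → ℝ) (lo hi w₀ v₁ p₁ : ℝ) : Prop where
  lo_lt_hi : lo < hi
  w₀_pos : 0 < w₀
  w₀_le : w₀ ≤ 1 / 2
  one_le : 1 ≤ v₁
  p₁_pos : 0 < p₁
  lip : ∀ a b, 0 < a → a ≤ b → ∃ K : NNReal,
    LipschitzOnWith K (fun q : ℝ × ℝ × ℝ => f q.1 q.2.1 q.2.2)
      (Icc a b ×ˢ Icc lo hi ×ˢ Icc w₀ v₁)
  lower : ∀ p > 0, f p lo 1 < 0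
  upper : ∀ p > 0, 0 < f p hi 1
  top : ∀ p > 0, ∀ U ∈ Icc lo hi, f p U v₁ < 0
  half : ∀ p > 0, p ≤ p₁ → ∀ U ∈ Icc lo hi, 0 < f p U (1 / 2)
  bot : ∀ p ≥ p₁, ∀ U ∈ Icc lo hi, f p U w₀ < 0

/-- The vector field `(v - 1, f p U v)`, evaluated at the point of the box
`[lo, hi] × [w₀, v₁]` nearest to `(U, v)`. It is bounded and Lipschitz, so that its orbits are
global, and it agrees with the original field along the orbits that stay in the box. -/
def clampedField (f : ℝ → ℝ → ℝ → ℝ) (lo hi w₀ v₁ : ℝ) (p : ℝ) (y : ℝ × ℝ) : ℝ × ℝ :=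
  (clamp w₀ v₁ y.2 - 1, f p (clamp lo hi y.1) (clamp w₀ v₁ y.2))

namespace IsTrapping

variable {f : ℝ → ℝ → ℝ → ℝ} {lo hi w₀ v₁ p₁ : ℝ}

lemma w₀_le_v₁ (h : IsTrapping f lo hi w₀ v₁ p₁) : w₀ ≤ v₁ := by
  linarith [h.w₀_le, h.one_le]

lemma clamp_one (h : IsTrapping f lo hi w₀ v₁ p₁) : clamp w₀ v₁ 1 = 1 :=
  clamp_of_mem ⟨by linarith [h.w₀_le], h.one_le⟩

open NNReal in
lemma exists_lipschitzWith (h : IsTrapping f lo hi w₀ v₁ p₁) {a b : ℝ} (ha : 0 < a)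
    (hab : a ≤ b) :
    ∃ K : ℝ≥0, ∀ p ∈ Icc a b, LipschitzWith K (clampedField f lo hi w₀ v₁ p) := by
  obtain ⟨K, hK⟩ := h.lip a b ha hab
  refine ⟨max 1 K, fun p hp => ?_⟩
  have hc : LipschitzWith 1 fun y : ℝ × ℝ => (p, clamp lo hi y.1, clamp w₀ v₁ y.2) := by
    have h1 : LipschitzWith 1 fun y : ℝ × ℝ => clamp lo hi y.1 := by
      simpa [Function.comp_def] using (lipschitzWith_clamp lo hi).comp LipschitzWith.prod_fst
    have h2 : LipschitzWith 1 fun y : ℝ × ℝ => clamp w₀ v₁ y.2 := by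
      simpa [Function.comp_def] using (lipschitzWith_clamp w₀ v₁).comp LipschitzWith.prod_snd
    simpa using (LipschitzWith.const p).prodMk (h1.prodMk h2)
  refine LipschitzWith.prodMk ?_ ?_
  · have h2 : LipschitzWith 1 fun y : ℝ × ℝ => clamp w₀ v₁ y.2 := by
      simpa [Function.comp_def] using (lipschitzWith_clamp w₀ v₁).comp LipschitzWith.prod_snd
    have := h2.sub (LipschitzWith.const (1 : ℝ))
    simpa using this
  · have := hK.comp (hc.lipschitzOnWith (s := univ)) (fun y _ =>
      ⟨hp, clamp_mem h.lo_lt_hi.le _, clamp_mem h.w₀_le_v₁ _⟩)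
    rw [lipschitzOnWith_univ] at this
    simpa [Function.comp_def] using this

lemma continuousOn_clampedField (h : IsTrapping f lo hi w₀ v₁ p₁) {a b : ℝ} (ha : 0 < a)
    (hab : a ≤ b) (y : ℝ × ℝ) :
    ContinuousOn (fun p => clampedField f lo hi w₀ v₁ p y) (Icc a b) := by
  obtain ⟨K, hK⟩ := h.lip a b ha hab
  refine continuousOn_const.prodMk ?_
  exact hK.continuousOn.comp (f := fun p : ℝ => (p, clamp lo hi y.1, clamp w₀ v₁ y.2))
    (by fun_prop) (fun p hp => ⟨hp, clamp_mem h.lo_lt_hi.le _, clamp_mem h.w₀_le_v₁ _⟩)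

open NNReal in
lemma exists_norm_le (h : IsTrapping f lo hi w₀ v₁ p₁) {a b : ℝ} (ha : 0 < a)
    (hab : a ≤ b) : ∃ L : ℝ≥0, ∀ p ∈ Icc a b, ∀ y, ‖clampedField f lo hi w₀ v₁ p y‖ ≤ L := by
  obtain ⟨K, hK⟩ := h.lip a b ha hab
  have hcomp : IsCompact (Icc a b ×ˢ Icc lo hi ×ˢ Icc w₀ v₁) :=
    isCompact_Icc.prod (isCompact_Icc.prod isCompact_Icc)
  obtain ⟨C, hC⟩ := hcomp.exists_bound_of_continuousOn
    (f := fun q : ℝ × ℝ × ℝ => (q.2.2 - 1, f q.1 q.2.1 q.2.2))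
    (ContinuousOn.prodMk (by fun_prop) hK.continuousOn)
  refine ⟨C.toNNReal, fun p hp y => ?_⟩
  exact (hC (p, clamp lo hi y.1, clamp w₀ v₁ y.2)
    ⟨hp, clamp_mem h.lo_lt_hi.le _, clamp_mem h.w₀_le_v₁ _⟩).trans (Real.le_coe_toNNReal C)

open NNReal in
/-- The clamped field has a flow on every compact interval of `(0, ∞)`, Lipschitz in the initial
value; the field being bounded, the Picard–Lindelöf radius can be taken as large as needed. -/
lemma exists_flow (h : IsTrapping f lo hi w₀ v₁ p₁) {a b t₀ : ℝ} (ha : 0 < a)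
    (ht₀ : t₀ ∈ Icc a b) (x₀ : ℝ × ℝ) (r : ℝ≥0) :
    ∃ α : ℝ × ℝ → ℝ → ℝ × ℝ, (∀ x ∈ Metric.closedBall x₀ r, α x t₀ = x ∧ ∀ t ∈ Icc a b,
        HasDerivWithinAt (α x) (clampedField f lo hi w₀ v₁ t (α x t)) (Icc a b) t) ∧
      ∃ K : ℝ≥0, ∀ t ∈ Icc a b, LipschitzOnWith K (α · t) (Metric.closedBall x₀ r) := by
  have hab : a ≤ b := ht₀.1.trans ht₀.2
  obtain ⟨K, hK⟩ := h.exists_lipschitzWith ha hab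
  obtain ⟨L, hL⟩ := h.exists_norm_le ha hab
  have hpl : IsPicardLindelof (clampedField f lo hi w₀ v₁) (tmin := a) (tmax := b) ⟨t₀, ht₀⟩ x₀
      (L * (b - a).toNNReal + r) r L K := by
    refine ⟨fun t ht => (hK t ht).lipschitzOnWith, fun x _ => h.continuousOn_clampedField ha hab x,
      fun t ht x _ => hL t ht x, ?_⟩
    push_cast
    rw [Real.coe_toNNReal _ (sub_nonneg.2 hab), add_sub_cancel_right]
    refine mul_le_mul_of_nonneg_left ?_ L.2
    exact max_le (sub_le_sub_left ht₀.1 b) (sub_le_sub_right ht₀.2 a)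
  exact hpl.exists_forall_mem_closedBall_eq_hasDerivWithinAt_lipschitzOnWith

end IsTrapping

/-! ### Shooting in the clamped system -/

/-- Suppose that `D` is monotone in the sense dictated by the sign of `w`, and that the quadrant
`D ≤ 0`, `w ≤ 0` cannot be left. If `D` starts nonnegative and ends positive, then `D` is never
negative: at a time where `D < 0` has just become true, the orbit would be in that quadrant. -/
lemma nonneg_of_pos_end {a b : ℝ} {D w D' w' : ℝ → ℝ}
    (hD : ∀ t ∈ Icc a b, HasDerivWithinAt D (D' t) (Icc a b) t)
    (hw : ∀ t ∈ Icc a b, HasDerivWithinAt w (w' t) (Icc a b) t)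
    (h1 : ∀ t ∈ Icc a b, w t ≤ 0 → D' t ≤ 0)
    (h1' : ∀ t ∈ Icc a b, 0 ≤ w t → 0 ≤ D' t)
    (h2 : ∀ t ∈ Icc a b, D t ≤ 0 → w t = 0 → w' t < 0)
    (hDa : 0 ≤ D a) (hDb : 0 < D b) : ∀ t ∈ Icc a b, 0 ≤ D t := by
  intro t ht
  by_contra! hlt
  have hat : a < t := lt_of_le_of_ne ht.1 (by rintro rfl; linarith)
  obtain ⟨c, hc, hc', hc''⟩ : ∃ c ∈ Ioo a t, w c < 0 ∧ D c < 0 := by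
    by_contra! hcon
    have hcont : ContinuousOn D (Icc a t) := fun s hs =>
      ((hD s ⟨hs.1, hs.2.trans ht.2⟩).continuousWithinAt).mono (Icc_subset_Icc_right ht.2)
    -- the last time before `t` at which `0 ≤ D`
    set S := Icc a t ∩ D ⁻¹' Ici 0
    have hScl : IsClosed S := hcont.preimage_isClosed_of_isClosed isClosed_Icc isClosed_Ici
    have hSbdd : BddAbove S := ⟨t, fun s hs => hs.1.2⟩
    have hSne : S.Nonempty := ⟨a, ⟨le_rfl, hat.le⟩, hDa⟩
    have hmem := hScl.csSup_mem hSne hSbdd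
    set e := sSup S
    have h2 : 0 ≤ D e := hmem.2
    have het : e < t := lt_of_le_of_ne hmem.1.2 (by
      intro heq
      rw [heq] at h2
      linarith)
    have hsub : Icc e t ⊆ Icc a b := Icc_subset_Icc hmem.1.1 ht.2
    have hmono : MonotoneOn D (Icc e t) := by
      refine monotoneOn_of_hasDerivWithinAt_nonneg (f' := D') (convex_Icc _ _)
        (hcont.mono (Icc_subset_Icc_left hmem.1.1)) ?_ ?_
      · intro s hs
        rw [interior_Icc] at hs ⊢
        exact (hD s (hsub (Ioo_subset_Icc_self hs))).mono (Ioo_subset_Icc_self.trans hsub)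
      · intro s hs
        rw [interior_Icc] at hs
        refine h1' s (hsub (Ioo_subset_Icc_self hs)) ?_
        by_contra! hws
        have : s ≤ e := le_csSup hSbdd ⟨⟨hmem.1.1.trans hs.1.le, hs.2.le⟩,
          hcon s ⟨hmem.1.1.trans_lt hs.1, hs.2⟩ hws⟩
        linarith [hs.1]
    have h1 := hmono (left_mem_Icc.2 het.le) (right_mem_Icc.2 het.le) het.le
    linarith
  have hsub : Icc c b ⊆ Icc a b := Icc_subset_Icc_left hc.1.le
  have hq := quadrant_forward_invariant (a := c) (b := b)
    (fun s hs => (hD s (hsub hs)).mono hsub) (fun s hs => (hw s (hsub hs)).mono hsub)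
    (fun s hs => h1 s (hsub hs)) (fun s hs => h2 s (hsub hs))
    hc''.le hc'.le b ⟨hc.2.le.trans ht.2, le_rfl⟩
  linarith [hq.1]

lemma HasDerivWithinAt.prod_components {y : ℝ → ℝ × ℝ} {y' : ℝ × ℝ} {s : Set ℝ} {t : ℝ}
    (h : HasDerivWithinAt y y' s t) :
    HasDerivWithinAt (fun t => (y t).1) y'.1 s t ∧ HasDerivWithinAt (fun t => (y t).2) y'.2 s t := by
  have h' := h.hasFDerivWithinAt
  exact ⟨by simpa using h'.fst.hasDerivWithinAt, by simpa using h'.snd.hasDerivWithinAt⟩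

namespace IsTrapping

variable {f : ℝ → ℝ → ℝ → ℝ} {lo hi w₀ v₁ p₁ : ℝ}

lemma clamp_sub_one_nonpos (h : IsTrapping f lo hi w₀ v₁ p₁) {v : ℝ} (hv : v ≤ 1) :
    clamp w₀ v₁ v - 1 ≤ 0 := by
  have := clamp_mono (a := w₀) (b := v₁) hv
  rw [h.clamp_one] at this
  linarith

lemma clamp_sub_one_nonneg (h : IsTrapping f lo hi w₀ v₁ p₁) {v : ℝ} (hv : 1 ≤ v) :
    0 ≤ clamp w₀ v₁ v - 1 := by
  have := clamp_mono (a := w₀) (b := v₁) hv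
  rw [h.clamp_one] at this
  linarith

/-- Shooting. Among the orbits of the clamped field that start at time `ε` with `v = 1` and
`U ∈ [lo, hi]`, the intermediate value theorem finds one with `lo < U < hi` at the final time. By
`nonneg_of_pos_end` it has not crossed `U = lo` or `U = hi` before. Below `v = w₀` it would drift
down at a definite rate, so `w₀ ≤ v` holds except possibly near the final time. -/
lemma exists_trapped (h : IsTrapping f lo hi w₀ v₁ p₁) {ε N : ℝ} (hε : 0 < ε) (hεp : ε ≤ p₁)
    (hN : p₁ ≤ N) : ∃ y : ℝ → ℝ × ℝ, ∀ t ∈ Icc ε N,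
      HasDerivWithinAt y (clampedField f lo hi w₀ v₁ t (y t)) (Icc ε N) t ∧
      (y t).1 ∈ Icc lo hi ∧ (y t).2 ∈ Icc w₀ v₁ ∧ (t ≤ p₁ → 1 / 2 ≤ (y t).2) := by
  have hlh := h.lo_lt_hi
  obtain ⟨M, hM⟩ : ∃ M, M = N + 3 * (hi - lo) := ⟨_, rfl⟩
  have hNM : N ≤ M := by linarith
  have hεM : ε ≤ M := by linarith
  have hpos : ∀ t ∈ Icc ε M, 0 < t := fun t ht => hε.trans_le ht.1
  obtain ⟨α, hα, K, hK⟩ := h.exists_flow hε (left_mem_Icc.2 hεM) (lo, 1) (hi - lo).toNNReal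
  have hball : ∀ u ∈ Icc lo hi,
      ((u, 1) : ℝ × ℝ) ∈ Metric.closedBall (lo, 1) (hi - lo).toNNReal := by
    intro u hu
    rw [Real.coe_toNNReal _ (by linarith), Metric.mem_closedBall, Prod.dist_eq]
    simp only [dist_self, Real.dist_eq]
    rw [max_eq_left (abs_nonneg _), abs_of_nonneg (by linarith [hu.1])]
    linarith [hu.2]
  have hU : ∀ u ∈ Icc lo hi, ∀ t ∈ Icc ε M, HasDerivWithinAt (fun t => (α (u, 1) t).1)
      (clamp w₀ v₁ (α (u, 1) t).2 - 1) (Icc ε M) t := fun u hu t ht =>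
    ((hα _ (hball u hu)).2 t ht).prod_components.1
  have hV : ∀ u ∈ Icc lo hi, ∀ t ∈ Icc ε M, HasDerivWithinAt (fun t => (α (u, 1) t).2)
      (f t (clamp lo hi (α (u, 1) t).1) (clamp w₀ v₁ (α (u, 1) t).2)) (Icc ε M) t :=
    fun u hu t ht => ((hα _ (hball u hu)).2 t ht).prod_components.2
  have hcont : ContinuousOn (fun u : ℝ => (α (u, 1) M).1) (Icc lo hi) := by
    have := (hK M (right_mem_Icc.2 hεM)).continuousOn
    exact continuous_fst.comp_continuousOn
      (this.comp (f := fun u : ℝ => (u, (1 : ℝ))) (by fun_prop) hball)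
  have hlo_end : (α (lo, 1) M).1 ≤ lo := by
    have hl : lo ∈ Icc lo hi := left_mem_Icc.2 hlh.le
    have hini := (hα _ (hball lo hl)).1
    have := (quadrant_forward_invariant
      (fun t ht => (hU lo hl t ht).sub_const lo) (fun t ht => (hV lo hl t ht).sub_const 1)
      (fun t ht hw => h.clamp_sub_one_nonpos (sub_nonpos.1 hw))
      (fun t ht h1 h2 => by
        rw [sub_eq_zero.1 h2, h.clamp_one, clamp_of_le hlh.le (sub_nonpos.1 h1)]
        exact h.lower t (hpos t ht)) (by simp [hini]) (by simp [hini]) M (right_mem_Icc.2 hεM)).1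
    linarith
  have hhi_end : hi ≤ (α (hi, 1) M).1 := by
    have hl : hi ∈ Icc lo hi := right_mem_Icc.2 hlh.le
    have hini := (hα _ (hball hi hl)).1
    have := (quadrant_forward_invariant
      (fun t ht => (hU hi hl t ht).const_sub hi) (fun t ht => (hV hi hl t ht).const_sub 1)
      (fun t ht hw => neg_nonpos.2 (h.clamp_sub_one_nonneg (sub_nonpos.1 hw)))
      (fun t ht h1 h2 => by
        rw [← sub_eq_zero.1 h2, h.clamp_one, clamp_of_ge hlh.le (sub_nonpos.1 h1)]
        exact neg_lt_zero.2 (h.upper t (hpos t ht))) (by simp [hini]) (by simp [hini]) M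
        (right_mem_Icc.2 hεM)).1
    linarith
  obtain ⟨u, hu, huM⟩ := intermediate_value_Icc hlh.le hcont
    (show (lo + hi) / 2 ∈ Icc _ _ from ⟨by linarith, by linarith⟩)
  have hini := (hα _ (hball u hu)).1
  have hUu := hU u hu
  have hVu := hV u hu
  have hy := (hα _ (hball u hu)).2
  set y := α (u, 1)
  simp only at huM
  -- `U` ends at the midpoint of `(lo, hi)`, strictly between the barriers
  have hge : ∀ t ∈ Icc ε M, lo ≤ (y t).1 := by
    intro t ht
    have := nonneg_of_pos_end
      (fun t ht => (hUu t ht).sub_const lo) (fun t ht => (hVu t ht).sub_const 1)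
      (fun t ht hw => h.clamp_sub_one_nonpos (sub_nonpos.1 hw))
      (fun t ht hw => h.clamp_sub_one_nonneg (sub_nonneg.1 hw))
      (fun t ht h1 h2 => by
        rw [sub_eq_zero.1 h2, h.clamp_one, clamp_of_le hlh.le (sub_nonpos.1 h1)]
        exact h.lower t (hpos t ht)) (by simp [hini, hu.1]) (by linarith) t ht
    linarith
  have hle : ∀ t ∈ Icc ε M, (y t).1 ≤ hi := by
    intro t ht
    have := nonneg_of_pos_end
      (fun t ht => (hUu t ht).const_sub hi) (fun t ht => (hVu t ht).const_sub 1)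
      (fun t ht hw => neg_nonpos.2 (h.clamp_sub_one_nonneg (sub_nonpos.1 hw)))
      (fun t ht hw => neg_nonneg.2 (h.clamp_sub_one_nonpos (sub_nonneg.1 hw)))
      (fun t ht h1 h2 => by
        rw [← sub_eq_zero.1 h2, h.clamp_one, clamp_of_ge hlh.le (sub_nonpos.1 h1)]
        exact neg_lt_zero.2 (h.upper t (hpos t ht))) (by simp [hini, hu.2]) (by linarith) t ht
    linarith
  have hv₁ : ∀ t ∈ Icc ε M, (y t).2 ≤ v₁ := by
    intro t ht
    have := nonpos_forward_invariant (fun t ht => (hVu t ht).sub_const v₁)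
      (fun t ht h2 => by
        rw [sub_eq_zero.1 h2, clamp_of_ge h.w₀_le_v₁ le_rfl]
        exact h.top t (hpos t ht) _ (clamp_mem hlh.le _)) (by simp [hini, h.one_le]) t ht
    linarith
  have hhalf : ∀ t ∈ Icc ε M, t ≤ p₁ → 1 / 2 ≤ (y t).2 := by
    intro t ht htp
    have hsub : Icc ε p₁ ⊆ Icc ε M := Icc_subset_Icc_right (by linarith)
    have := nonpos_forward_invariant (a := ε) (b := p₁)
      (fun t ht => ((hVu t (hsub ht)).const_sub (1 / 2)).mono hsub)
      (fun t ht h2 => by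
        rw [← sub_eq_zero.1 h2, clamp_of_mem ⟨h.w₀_le, by linarith [h.one_le]⟩]
        exact neg_lt_zero.2 (h.half t (hpos t (hsub ht)) ht.2 _ (clamp_mem hlh.le _)))
      (by simp only [hini]; norm_num) t ⟨ht.1, htp⟩
    linarith
  refine ⟨y, fun t ht => ?_⟩
  have htM : t ∈ Icc ε M := ⟨ht.1, ht.2.trans hNM⟩
  refine ⟨(hy t htM).mono (Icc_subset_Icc_right hNM), ⟨hge t htM, hle t htM⟩,
    ⟨?_, hv₁ t htM⟩, hhalf t htM⟩
  by_contra! hlt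
  have htp : p₁ < t := by
    by_contra! hcon
    linarith [hhalf t htM hcon, h.w₀_le]
  have hsub : Icc t M ⊆ Icc ε M := Icc_subset_Icc_left ht.1
  have hlow : ∀ s ∈ Icc t M, (y s).2 ≤ w₀ := by
    intro s hs
    have := nonpos_forward_invariant (a := t) (b := M)
      (fun t ht => ((hVu t (hsub ht)).sub_const w₀).mono hsub)
      (fun s hs h2 => by
        rw [sub_eq_zero.1 h2, clamp_of_le h.w₀_le_v₁ le_rfl]
        exact h.bot s (htp.le.trans hs.1) _ (clamp_mem hlh.le _))
      (by linarith) s hs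
    linarith
  -- on `[t, M]` the function `U` decreases at the rate `1 - w₀ ≥ 1 / 2`
  have hanti : AntitoneOn (fun s => (y s).1 + s / 2) (Icc t M) := by
    have hd : ∀ s ∈ Icc t M, HasDerivWithinAt (fun s => (y s).1 + s / 2)
        (clamp w₀ v₁ (y s).2 - 1 + 1 / 2) (Icc t M) s := fun s hs =>
      ((hUu s (hsub hs)).mono hsub).add ((hasDerivWithinAt_id s _).div_const 2)
    refine antitoneOn_of_hasDerivWithinAt_nonpos
      (f' := fun s => clamp w₀ v₁ (y s).2 - 1 + 1 / 2) (convex_Icc _ _)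
      (fun s hs => (hd s hs).continuousWithinAt) ?_ ?_
    · intro s hs
      rw [interior_Icc] at hs ⊢
      exact (hd s (Ioo_subset_Icc_self hs)).mono Ioo_subset_Icc_self
    · intro s hs
      rw [interior_Icc] at hs
      rw [clamp_of_le h.w₀_le_v₁ (hlow s (Ioo_subset_Icc_self hs))]
      linarith [h.w₀_le]
  have hfin := hanti (left_mem_Icc.2 htM.2) (right_mem_Icc.2 htM.2) htM.2
  have h1 := hle t htM
  have h2 := ht.2
  simp only at hfin
  linarith

end IsTrapping

/-! ### The limit orbit -/

namespace IsTrapping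

variable {f : ℝ → ℝ → ℝ → ℝ} {lo hi w₀ v₁ p₁ : ℝ}

lemma eqOn_of_eq_at (h : IsTrapping f lo hi w₀ v₁ p₁) {a b t₀ : ℝ} (ha : 0 < a)
    (ht₀ : t₀ ∈ Ioo a b) {y z : ℝ → ℝ × ℝ}
    (hy : ∀ t ∈ Icc a b, HasDerivWithinAt y (clampedField f lo hi w₀ v₁ t (y t)) (Icc a b) t)
    (hz : ∀ t ∈ Icc a b, HasDerivWithinAt z (clampedField f lo hi w₀ v₁ t (z t)) (Icc a b) t)
    (heq : y t₀ = z t₀) : EqOn y z (Icc a b) := by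
  obtain ⟨K, hK⟩ := h.exists_lipschitzWith ha (ht₀.1.trans ht₀.2).le
  exact ODE_solution_unique_of_mem_Icc (s := fun _ => univ)
    (fun t ht => (hK t (Ioo_subset_Icc_self ht)).lipschitzOnWith) ht₀
    (fun t ht => (hy t ht).continuousWithinAt)
    (fun t ht => (hy t (Ioo_subset_Icc_self ht)).hasDerivAt (Icc_mem_nhds ht.1 ht.2))
    (fun _ _ => mem_univ _)
    (fun t ht => (hz t ht).continuousWithinAt)
    (fun t ht => (hz t (Ioo_subset_Icc_self ht)).hasDerivAt (Icc_mem_nhds ht.1 ht.2))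
    (fun _ _ => mem_univ _) heq

open Topology in
/-- The trapped orbits on `[1 / n, n]` have their values at time `1` in a compact box. Along a
subsequence these converge, and continuous dependence on the initial value carries the
convergence to all of `(0, ∞)`. -/
theorem exists_global (h : IsTrapping f lo hi w₀ v₁ p₁) : ∃ U v : ℝ → ℝ, ∀ t > 0,
      HasDerivAt U (v t - 1) t ∧ HasDerivAt v (f t (U t) (v t)) t ∧
      U t ∈ Icc lo hi ∧ v t ∈ Icc w₀ v₁ ∧ (t ≤ p₁ → 1 / 2 ≤ v t) := by
  have hp₁ := h.p₁_pos
  obtain ⟨n₀, hn₀⟩ : ∃ n₀ : ℕ, max p₁ (max p₁⁻¹ 2) ≤ n₀ := exists_nat_ge _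
  have hn₁ : p₁ ≤ n₀ := (le_max_left _ _).trans hn₀
  have hn₂ : p₁⁻¹ ≤ n₀ := (le_max_left _ _).trans ((le_max_right _ _).trans hn₀)
  have hn₃ : (2 : ℝ) ≤ n₀ := (le_max_right _ _).trans ((le_max_right _ _).trans hn₀)
  have hex : ∀ n : ℕ, ∃ y : ℝ → ℝ × ℝ, ∀ t ∈ Icc ((n + n₀ : ℝ)⁻¹) (n + n₀ : ℝ),
      HasDerivWithinAt y (clampedField f lo hi w₀ v₁ t (y t))
        (Icc ((n + n₀ : ℝ)⁻¹) (n + n₀ : ℝ)) t ∧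
      (y t).1 ∈ Icc lo hi ∧ (y t).2 ∈ Icc w₀ v₁ ∧ (t ≤ p₁ → 1 / 2 ≤ (y t).2) := by
    intro n
    have hn : (0 : ℝ) ≤ n := n.cast_nonneg
    refine h.exists_trapped (by positivity) ?_ (by linarith)
    exact inv_le_of_inv_le₀ hp₁ (by linarith)
  choose y hy using hex
  have hone : ∀ n : ℕ, (1 : ℝ) ∈ Icc ((n + n₀ : ℝ)⁻¹) (n + n₀ : ℝ) := by
    intro n
    have hn : (0 : ℝ) ≤ n := n.cast_nonneg
    exact ⟨inv_le_one_of_one_le₀ (by linarith), by linarith⟩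
  have hbox : IsCompact (Icc lo hi ×ˢ Icc w₀ v₁) := isCompact_Icc.prod isCompact_Icc
  obtain ⟨x, -, φ, hφ, hlim⟩ := hbox.tendsto_subseq (x := fun n => y n 1)
    (fun n => ⟨(hy n 1 (hone n)).2.1, (hy n 1 (hone n)).2.2.1⟩)
  have hx1 : x ∈ Metric.closedBall x ((1 : NNReal) : ℝ) := Metric.mem_closedBall_self (by simp)
  have hev : ∀ᶠ k in atTop, y (φ k) 1 ∈ Metric.closedBall x ((1 : NNReal) : ℝ) :=
    hlim.eventually (Metric.closedBall_mem_nhds x (by simp))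
  have hloc : ∀ b : ℝ, 1 < b → ∃ β : ℝ → ℝ × ℝ, ∀ t ∈ Icc b⁻¹ b,
      HasDerivWithinAt β (clampedField f lo hi w₀ v₁ t (β t)) (Icc b⁻¹ b) t ∧
      Tendsto (fun k => y (φ k) t) atTop (𝓝 (β t)) := by
    intro b hb
    have hb0 : 0 < b⁻¹ := inv_pos.2 (by linarith)
    have h1b : (1 : ℝ) ∈ Ioo b⁻¹ b := ⟨inv_lt_one_of_one_lt₀ hb, hb⟩
    obtain ⟨α, hα, K, hK⟩ := h.exists_flow hb0 (Ioo_subset_Icc_self h1b) x 1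
    refine ⟨α x, fun t ht => ⟨(hα x hx1).2 t ht, ?_⟩⟩
    have hlarge : ∀ᶠ k in atTop, b ≤ (φ k : ℝ) :=
      (tendsto_natCast_atTop_atTop.comp hφ.tendsto_atTop).eventually_ge_atTop b
    have heq : ∀ᶠ k in atTop, α (y (φ k) 1) t = y (φ k) t := by
      filter_upwards [hev, hlarge] with k hk hkb
      have hle : b ≤ (φ k + n₀ : ℝ) := by linarith
      have hsub : Icc b⁻¹ b ⊆ Icc ((φ k + n₀ : ℝ)⁻¹) (φ k + n₀ : ℝ) :=
        Icc_subset_Icc (inv_anti₀ (by linarith) hle) hle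
      exact h.eqOn_of_eq_at hb0 h1b (hα _ hk).2
        (fun s hs => (hy (φ k) s (hsub hs)).1.mono hsub) (hα _ hk).1 ht
    refine Tendsto.congr' heq ?_
    have hc : ContinuousWithinAt (α · t) (Metric.closedBall x ((1 : NNReal) : ℝ)) x :=
      (hK t ht).continuousOn x hx1
    exact hc.tendsto.comp (tendsto_nhdsWithin_iff.2 ⟨hlim, hev⟩)
  have hpt : ∀ t : ℝ, ∃ z : ℝ × ℝ, 0 < t → Tendsto (fun k => y (φ k) t) atTop (𝓝 z) := by
    intro t
    by_cases ht : 0 < t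
    · obtain ⟨β, hβ⟩ := hloc (t + t⁻¹ + 1) (by have := inv_pos.2 ht; linarith)
      have hti := inv_pos.2 ht
      exact ⟨β t, fun _ => (hβ t ⟨inv_le_of_inv_le₀ ht (by linarith), by linarith⟩).2⟩
    · exact ⟨0, fun h => absurd h ht⟩
  choose z hz using hpt
  have hbounds : ∀ t > 0, (z t).1 ∈ Icc lo hi ∧ (z t).2 ∈ Icc w₀ v₁ ∧
      (t ≤ p₁ → 1 / 2 ≤ (z t).2) := by
    intro t ht
    have hlarge : ∀ᶠ k in atTop, t + t⁻¹ ≤ (φ k : ℝ) :=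
      (tendsto_natCast_atTop_atTop.comp hφ.tendsto_atTop).eventually_ge_atTop _
    have hti := inv_pos.2 ht
    have hmem : ∀ᶠ k in atTop, t ∈ Icc ((φ k + n₀ : ℝ)⁻¹) (φ k + n₀ : ℝ) := by
      filter_upwards [hlarge] with k hk
      exact ⟨inv_le_of_inv_le₀ ht (by linarith), by linarith⟩
    have h1 := (continuous_fst.tendsto _).comp (hz t ht)
    have h2 := (continuous_snd.tendsto _).comp (hz t ht)
    refine ⟨isClosed_Icc.mem_of_tendsto h1 (hmem.mono fun k hk => (hy _ t hk).2.1),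
      isClosed_Icc.mem_of_tendsto h2 (hmem.mono fun k hk => (hy _ t hk).2.2.1),
      fun htp => ge_of_tendsto h2 (hmem.mono fun k hk => (hy _ t hk).2.2.2 htp)⟩
  refine ⟨fun t => (z t).1, fun t => (z t).2, fun t ht => ?_⟩
  obtain ⟨hU, hv, hhalf⟩ := hbounds t ht
  have hti := inv_pos.2 ht
  obtain ⟨b, hb⟩ : ∃ b, b = t + t⁻¹ + 1 := ⟨_, rfl⟩
  have hb1 : 1 < b := by linarith
  have htb : t ∈ Ioo b⁻¹ b := ⟨inv_lt_of_inv_lt₀ ht (by linarith), by linarith⟩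
  obtain ⟨β, hβ⟩ := hloc b hb1
  have hzβ : ∀ s ∈ Icc b⁻¹ b, z s = β s := fun s hs =>
    tendsto_nhds_unique (hz s ((inv_pos.2 (by linarith)).trans_le hs.1)) (hβ s hs).2
  have hd : HasDerivAt z (clampedField f lo hi w₀ v₁ t (z t)) t := by
    have h1 := ((hβ t (Ioo_subset_Icc_self htb)).1.congr hzβ
      (hzβ t (Ioo_subset_Icc_self htb))).hasDerivAt (Icc_mem_nhds htb.1 htb.2)
    rwa [← hzβ t (Ioo_subset_Icc_self htb)] at h1
  have hd' := hd.hasDerivWithinAt (s := univ) |>.prod_components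
  simp only [clampedField, clamp_of_mem hU, clamp_of_mem hv, hasDerivWithinAt_univ] at hd'
  exact ⟨hd'.1, hd'.2, hU, hv, hhalf⟩

end IsTrapping

/-! ### The field of the profile equation and its barriers -/

/-- The right-hand side of the second-order equation `V'' = profileField σ μ ρ p V V'` satisfied by
`V`, a power of the similarity variable, as a function of `p = φ ^ (1 - β)`. -/
noncomputable def profileField (σ μ ρ p V v : ℝ) : ℝ :=
  (1 - σ / 2) * v ^ 2 / V - μ * v / p
    + (σ + 2 * μ - 2) * p ^ (-σ) * V ^ (σ - 2) * v ^ 2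
      * ((σ + 1) / 2 * V - σ / 2 * (p + ρ) * v)

lemma profileField_eq {σ μ ρ p V v : ℝ} (hp : 0 < p) (hV : 0 < V) :
    profileField σ μ ρ p V v = v / (p * V) * ((1 - σ / 2) * v * p - μ * V
      + (σ + 2 * μ - 2) * (V / p) ^ (σ - 1) * v * ((σ + 1) / 2 * V - σ / 2 * (p + ρ) * v)) := by
  have h1 : p ^ (-σ) = p ^ (1 - σ) / p := by
    rw [show -σ = (1 - σ) - 1 by ring, Real.rpow_sub_one hp.ne']
  have h2 : V ^ (σ - 2) = V ^ (σ - 1) / V := by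
    rw [show σ - 2 = (σ - 1) - 1 by ring, Real.rpow_sub_one hV.ne']
  have h3 : (V / p) ^ (σ - 1) = V ^ (σ - 1) * p ^ (1 - σ) := by
    rw [Real.div_rpow hV.le hp.le, show (1 - σ) = -(σ - 1) by ring, Real.rpow_neg hp.le]
    rfl
  rw [profileField, h1, h2, h3]
  field_simp

lemma one_le_div_rpow {σ p V : ℝ} (hσ : 1 < σ) (hp : 0 < p) (hV : p ≤ V) :
    1 ≤ (V / p) ^ (σ - 1) :=
  Real.one_le_rpow ((one_le_div hp).2 hV) (by linarith)

/-- An orbit on the half-line `V = p + ρ / 2` with slope `1` bends below it. This rests on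
`(1 + t) ^ (σ - 1) * (1 - (σ - 1) * t) ≤ 1`. -/
lemma profileField_lower {σ μ ρ p : ℝ} (hσ : 1 < σ) (hμ : 1 < μ) (hρ : 0 < ρ) (hp : 0 < p) :
    profileField σ μ ρ p (p + ρ / 2) 1 < 0 := by
  have hV : 0 < p + ρ / 2 := by positivity
  rw [profileField_eq hp hV]
  refine mul_neg_of_pos_of_neg (by positivity) ?_
  have hR : ((p + ρ / 2) / p) ^ (σ - 1) * (p - (σ - 1) * (ρ / 2)) ≤ p := by
    obtain ⟨t, ht⟩ : ∃ t, t = ρ / 2 / p := ⟨_, rfl⟩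
    have ht0 : 0 < t := by rw [ht]; positivity
    have hb : ρ / 2 = t * p := by rw [ht]; field_simp
    have h1 : (p + ρ / 2) / p = 1 + t := by rw [hb]; field_simp
    rw [h1, hb]
    have h2 : (1 + t) ^ (σ - 1) ≤ Real.exp ((σ - 1) * t) := by
      rw [mul_comm, Real.exp_mul]
      exact Real.rpow_le_rpow (by linarith) (by linarith [Real.add_one_le_exp t]) (by linarith)
    have h3 : 1 - (σ - 1) * t ≤ Real.exp (-((σ - 1) * t)) := by
      linarith [Real.add_one_le_exp (-((σ - 1) * t))]
    have h4 : (1 + t) ^ (σ - 1) * (1 - (σ - 1) * t) ≤ 1 := by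
      calc (1 + t) ^ (σ - 1) * (1 - (σ - 1) * t)
          ≤ (1 + t) ^ (σ - 1) * Real.exp (-((σ - 1) * t)) := by gcongr
        _ ≤ Real.exp ((σ - 1) * t) * Real.exp (-((σ - 1) * t)) := by gcongr
        _ = 1 := by rw [← Real.exp_add]; simp
    nlinarith
  nlinarith [mul_pos (by linarith : 0 < μ) hρ, mul_le_mul_of_nonneg_left hR
    (by linarith : 0 ≤ (σ + 2 * μ - 2))]

/-- An orbit on the half-line `V = p + ρ * σ / (σ - 1)` with slope `1` bends above it. -/
lemma profileField_upper {σ μ ρ p : ℝ} (hσ : 1 < σ) (hμ : 1 < μ) (hρ : 0 < ρ) (hp : 0 < p) :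
    0 < profileField σ μ ρ p (p + ρ * σ / (σ - 1)) 1 := by
  have hσ1 : 0 < σ - 1 := by linarith
  obtain ⟨b, hb⟩ : ∃ b, b = ρ * σ / (σ - 1) := ⟨_, rfl⟩
  have hb0 : 0 < b := by rw [hb]; positivity
  have hρb : σ * ρ = b * (σ - 1) := by rw [hb]; field_simp
  rw [← hb, profileField_eq hp (by linarith)]
  refine mul_pos (by positivity) ?_
  have hR : 1 ≤ ((p + b) / p) ^ (σ - 1) := one_le_div_rpow hσ hp (by linarith)
  have h1 : (σ + 1) / 2 * (p + b) - σ / 2 * (p + ρ) * 1 = p / 2 + b := by linear_combination -hρb / 2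
  rw [h1]
  have h2 : (σ + 2 * μ - 2) * (p / 2 + b) ≤
      (σ + 2 * μ - 2) * ((p + b) / p) ^ (σ - 1) * 1 * (p / 2 + b) := by
    have : 0 ≤ (σ + 2 * μ - 2) * (p / 2 + b) := by
      apply mul_nonneg <;> linarith
    nlinarith
  nlinarith [mul_pos (by linarith : 0 < σ + μ - 2) hb0]

/-- The slope `(σ + 1) / (σ - 1)` is large enough for the last factor of `profileField` to be at most
`-p / 2` all over the strip. -/
lemma profileField_top {σ μ ρ p V : ℝ} (hσ : 1 < σ) (hμ : 1 < μ) (hp : 0 < p)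
    (hV : p ≤ V) (hV' : V ≤ p + ρ * σ / (σ - 1)) :
    profileField σ μ ρ p V ((σ + 1) / (σ - 1)) < 0 := by
  have hσ1 : 0 < σ - 1 := by linarith
  have hVp : 0 < V := by linarith
  obtain ⟨v, hv⟩ : ∃ v, v = (σ + 1) / (σ - 1) := ⟨_, rfl⟩
  have hv0 : 0 < v := by rw [hv]; positivity
  have hvσ : v * (σ - 1) = σ + 1 := by rw [hv]; field_simp
  rw [← hv, profileField_eq hp hVp]
  refine mul_neg_of_pos_of_neg (by positivity) ?_
  have hR : 1 ≤ (V / p) ^ (σ - 1) := one_le_div_rpow hσ hp hV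
  have hB : (σ + 1) / 2 * V - σ / 2 * (p + ρ) * v ≤ -p / 2 := by
    have h1 : (σ + 1) / 2 * V ≤ (σ + 1) / 2 * (p + ρ * σ / (σ - 1)) := by gcongr
    have h2 : (σ + 1) * (ρ * σ / (σ - 1)) = σ * ρ * v := by rw [hv]; ring
    have h3 : σ + 2 ≤ σ * v := by nlinarith
    nlinarith
  have hc : 0 < σ + 2 * μ - 2 := by linarith
  have h4 : (σ + 2 * μ - 2) * (V / p) ^ (σ - 1) * v * ((σ + 1) / 2 * V - σ / 2 * (p + ρ) * v)
      ≤ (σ + 2 * μ - 2) * 1 * v * (-p / 2) := by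
    have h5 : (σ + 2 * μ - 2) * 1 * v ≤ (σ + 2 * μ - 2) * (V / p) ^ (σ - 1) * v := by gcongr
    have h6 : 0 ≤ (σ + 2 * μ - 2) * 1 * v := by positivity
    nlinarith
  nlinarith [mul_pos hv0 hp, mul_pos (by linarith : 0 < σ + μ - 2) (mul_pos hv0 hp),
    mul_pos (by linarith : 0 < μ) hVp]

/-- The hypothesis on `V / p` holds for all small `p`. The slope `1 / 2` is small enough for the last
factor of `profileField` to be at least `V / 2` above the lower half-line. -/
lemma profileField_half {σ μ ρ p V : ℝ} (hσ : 1 < σ) (hμ : 1 < μ) (hρ : 0 < ρ) (hp : 0 < p)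
    (hV : p + ρ / 2 ≤ V)
    (hR : (4 * μ + σ) / (σ + 2 * μ - 2) < (V / p) ^ (σ - 1)) :
    0 < profileField σ μ ρ p V (1 / 2) := by
  have hVp : 0 < V := by linarith
  rw [profileField_eq hp hVp]
  refine mul_pos (by positivity) ?_
  have hc : 0 < σ + 2 * μ - 2 := by linarith
  rw [div_lt_iff₀ hc] at hR
  obtain ⟨R, hRdef⟩ : ∃ R, R = (σ + 2 * μ - 2) * (V / p) ^ (σ - 1) := ⟨_, rfl⟩
  rw [← hRdef]
  have hR' : 4 * μ + σ < R := by rw [hRdef]; linarith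
  have hB : V / 2 ≤ (σ + 1) / 2 * V - σ / 2 * (p + ρ) * (1 / 2) := by nlinarith
  have h1 : R * (V / 4) ≤ R * (1 / 2) * ((σ + 1) / 2 * V - σ / 2 * (p + ρ) * (1 / 2)) := by
    have : 0 < R := by linarith
    nlinarith
  nlinarith

/-- For very small slopes the linear term `-μ * v / p` of `profileField` dominates. -/
lemma profileField_bot {σ μ ρ p V v R : ℝ} (hσ : 1 < σ) (hμ : 1 < μ) (hρ : 0 < ρ) (hp : 0 < p)
    (hv : 0 < v) (hV : p ≤ V) (hR : (V / p) ^ (σ - 1) ≤ R)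
    (hvR : v * (1 + (σ + 2 * μ - 2) * R * ((σ + 1) / 2)) ≤ 1) :
    profileField σ μ ρ p V v < 0 := by
  have hVp : 0 < V := by linarith
  rw [profileField_eq hp hVp]
  refine mul_neg_of_pos_of_neg (by positivity) ?_
  have hc : 0 < σ + 2 * μ - 2 := by linarith
  have hQ0 : 0 ≤ (V / p) ^ (σ - 1) := by positivity
  have h1 : (σ + 2 * μ - 2) * (V / p) ^ (σ - 1) * v * ((σ + 1) / 2 * V - σ / 2 * (p + ρ) * v)
      ≤ (σ + 2 * μ - 2) * R * v * ((σ + 1) / 2 * V) := by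
    have h2 : (σ + 1) / 2 * V - σ / 2 * (p + ρ) * v ≤ (σ + 1) / 2 * V := by
      have : 0 ≤ σ / 2 * (p + ρ) * v := by positivity
      linarith
    calc _ ≤ (σ + 2 * μ - 2) * (V / p) ^ (σ - 1) * v * ((σ + 1) / 2 * V) := by gcongr
      _ ≤ _ := by gcongr
  have h3 : (1 - σ / 2) * v * p ≤ v * V := by
    nlinarith [mul_pos hv hp, mul_le_mul_of_nonneg_left hV hv.le]
  nlinarith

open Topology in
lemma exists_isTrapping {σ μ ρ : ℝ} (hσ : 1 < σ) (hμ : 1 < μ) (hρ : 0 < ρ) :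
    ∃ w₀ p₁ : ℝ, IsTrapping (fun p U v => profileField σ μ ρ p (p + U) v) (ρ / 2)
      (ρ * σ / (σ - 1)) w₀ ((σ + 1) / (σ - 1)) p₁ := by
  have hσ1 : 0 < σ - 1 := by linarith
  have hc : 0 < σ + 2 * μ - 2 := by linarith
  have hhi : 0 < ρ * σ / (σ - 1) := by positivity
  have hlim : Tendsto (fun p : ℝ => (ρ / 2 * p⁻¹) ^ (σ - 1)) (𝓝[>] 0) atTop :=
    (tendsto_rpow_atTop hσ1).comp
      (tendsto_inv_nhdsGT_zero.const_mul_atTop (by positivity))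
  obtain ⟨p₁, hp₁, hsmall⟩ := (mem_nhdsGT_iff_exists_Ioc_subset).1
    (hlim.eventually_gt_atTop ((4 * μ + σ) / (σ + 2 * μ - 2)))
  have hp₁ : 0 < p₁ := hp₁
  obtain ⟨R, hR⟩ : ∃ R, R = (1 + ρ * σ / (σ - 1) / p₁) ^ (σ - 1) := ⟨_, rfl⟩
  have hR1 : 0 < R := by rw [hR]; positivity
  obtain ⟨S, hS⟩ : ∃ S, S = 1 + (σ + 2 * μ - 2) * R * ((σ + 1) / 2) := ⟨_, rfl⟩
  have hS1 : 1 ≤ S := by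
    have : 0 ≤ (σ + 2 * μ - 2) * R * ((σ + 1) / 2) := by positivity
    linarith
  refine ⟨1 / (2 * S), p₁, ?_, by positivity, ?_, ?_, hp₁, ?_, ?_, ?_, ?_, ?_, ?_⟩
  · rw [lt_div_iff₀ hσ1]; nlinarith
  · exact one_div_le_one_div_of_le (by norm_num) (by linarith)
  · rw [one_le_div hσ1]; linarith
  · intro a b ha hab
    have hcd : ContDiffOn ℝ 1
        (fun q : ℝ × ℝ × ℝ => profileField σ μ ρ q.1 (q.1 + q.2.1) q.2.2)
        (Icc a b ×ˢ Icc (ρ / 2) (ρ * σ / (σ - 1)) ×ˢ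
          Icc (1 / (2 * S)) ((σ + 1) / (σ - 1))) := by
      have h1 : ∀ q ∈ Icc a b ×ˢ Icc (ρ / 2) (ρ * σ / (σ - 1)) ×ˢ
          Icc (1 / (2 * S)) ((σ + 1) / (σ - 1)), q.1 ≠ 0 := fun q hq =>
        (ha.trans_le hq.1.1).ne'
      have h2 : ∀ q ∈ Icc a b ×ˢ Icc (ρ / 2) (ρ * σ / (σ - 1)) ×ˢ
          Icc (1 / (2 * S)) ((σ + 1) / (σ - 1)), q.1 + q.2.1 ≠ 0 := fun q hq => by
        have h3 := hq.1.1
        have h4 := hq.2.1.1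
        have : 0 < q.1 + q.2.1 := by linarith
        exact this.ne'
      have hfst : ContDiffOn ℝ 1 (fun q : ℝ × ℝ × ℝ => q.1)
          (Icc a b ×ˢ Icc (ρ / 2) (ρ * σ / (σ - 1)) ×ˢ
          Icc (1 / (2 * S)) ((σ + 1) / (σ - 1))) := contDiff_fst.contDiffOn
      have hU : ContDiffOn ℝ 1 (fun q : ℝ × ℝ × ℝ => q.1 + q.2.1)
          (Icc a b ×ˢ Icc (ρ / 2) (ρ * σ / (σ - 1)) ×ˢ
          Icc (1 / (2 * S)) ((σ + 1) / (σ - 1))) :=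
        (contDiff_fst.add (contDiff_fst.comp contDiff_snd)).contDiffOn
      have hv : ContDiffOn ℝ 1 (fun q : ℝ × ℝ × ℝ => q.2.2)
          (Icc a b ×ˢ Icc (ρ / 2) (ρ * σ / (σ - 1)) ×ˢ
          Icc (1 / (2 * S)) ((σ + 1) / (σ - 1))) :=
        (contDiff_snd.comp contDiff_snd).contDiffOn
      unfold profileField
      exact ((((contDiffOn_const.mul (hv.pow 2)).div hU h2).sub
        ((contDiffOn_const.mul hv).div hfst h1)).add
        ((((contDiffOn_const.mul (hfst.rpow_const_of_ne h1)).mul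
          (hU.rpow_const_of_ne h2)).mul (hv.pow 2)).mul
          ((contDiffOn_const.mul hU).sub
            ((contDiffOn_const.mul (hfst.add contDiffOn_const)).mul hv))))
    exact hcd.exists_lipschitzOnWith one_ne_zero
      ((convex_Icc _ _).prod ((convex_Icc _ _).prod (convex_Icc _ _)))
      (isCompact_Icc.prod (isCompact_Icc.prod isCompact_Icc))
  · exact fun p hp => profileField_lower hσ hμ hρ hp
  · exact fun p hp => profileField_upper hσ hμ hρ hp
  · intro p hp U hU
    have := hU.1
    exact profileField_top hσ hμ hp (by linarith) (by linarith [hU.2])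
  · intro p hp hpp U hU
    have hUlo := hU.1
    refine profileField_half hσ hμ hρ hp (by linarith) ?_
    refine lt_of_lt_of_le (hsmall ⟨hp, hpp⟩) ?_
    refine Real.rpow_le_rpow (by positivity) ?_ hσ1.le
    rw [← div_eq_mul_inv]
    exact div_le_div_of_nonneg_right (by linarith) hp.le
  · intro p hp U hU
    have hp0 : 0 < p := hp₁.trans_le hp
    have hUlo := hU.1
    refine profileField_bot (R := R) hσ hμ hρ hp0 (by positivity) (by linarith) ?_ ?_
    · rw [hR]
      refine Real.rpow_le_rpow (div_nonneg (by linarith) hp0.le) ?_ hσ1.le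
      rw [add_div, div_self hp0.ne']
      have : U / p ≤ ρ * σ / (σ - 1) / p₁ := div_le_div₀ hhi.le hU.2 hp₁ hp
      linarith
    · rw [← hS]
      have : S ≠ 0 := by positivity
      field_simp
      norm_num

/-! ### Behaviour at the blow-up point -/

/-- If `w` decreases at least at the rate `1 / p` wherever it is nonnegative and is bounded above
near `0`, then it is nonpositive: a positive value would force `w` to grow like `-log p` as
`p → 0`. -/
lemma nonpos_of_deriv_le_neg_inv {w w' : ℝ → ℝ} {q C : ℝ}
    (hw : ∀ p ∈ Ioc 0 q, HasDerivAt w (w' p) p)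
    (hneg : ∀ p ∈ Ioc 0 q, 0 ≤ w p → w' p ≤ -p⁻¹)
    (hC : ∀ p ∈ Ioc 0 q, w p ≤ C) : ∀ p ∈ Ioc 0 q, w p ≤ 0 := by
  intro b hb
  by_contra! hpos
  have hall : ∀ p ∈ Ioc 0 b, 0 < w p := by
    intro p hp
    by_contra! hle
    have hsub : Icc p b ⊆ Ioc 0 q := fun t ht => ⟨hp.1.trans_le ht.1, ht.2.trans hb.2⟩
    have := nonpos_forward_invariant (fun t ht => (hw t (hsub ht)).hasDerivWithinAt)
      (fun t ht h0 => (hneg t (hsub ht) h0.ge).trans_lt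
        (neg_lt_zero.2 (inv_pos.2 (hsub ht).1))) hle b ⟨hp.2, le_rfl⟩
    linarith
  have hsub : Ioc 0 b ⊆ Ioc 0 q := Ioc_subset_Ioc_right hb.2
  have hd : ∀ p ∈ Ioc 0 b, HasDerivAt (fun p => w p + Real.log p) (w' p + p⁻¹) p :=
    fun p hp => (hw p (hsub hp)).add (Real.hasDerivAt_log hp.1.ne')
  have hanti : AntitoneOn (fun p => w p + Real.log p) (Ioc 0 b) := by
    refine antitoneOn_of_hasDerivWithinAt_nonpos (f' := fun p => w' p + p⁻¹) (convex_Ioc _ _)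
      (fun p hp => (hd p hp).continuousAt.continuousWithinAt)
      (fun p hp => (hd p (interior_subset hp)).hasDerivWithinAt) ?_
    intro p hp
    have hp' := interior_subset hp
    linarith [hneg p (hsub hp') (hall p hp').le]
  have hC0 := hC b hb
  obtain ⟨p, hpdef⟩ : ∃ p, p = b * Real.exp (-(C + 1)) := ⟨_, rfl⟩
  have hp : p ∈ Ioc 0 b := by
    rw [hpdef]
    have hb0 := hb.1
    refine ⟨by positivity, mul_le_of_le_one_right hb0.le ?_⟩
    rw [Real.exp_le_one_iff]; linarith
  have h1 := hanti hp ⟨hb.1, le_rfl⟩ hp.2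
  have h2 : Real.log p = Real.log b - (C + 1) := by
    rw [hpdef, Real.log_mul hb.1.ne' (Real.exp_ne_zero _), Real.log_exp]; ring
  have h3 := hC p (hsub hp)
  simp only [h2] at h1
  linarith

open Topology in
/-- The term of `profileField` with the factor `(V / p) ^ (σ - 1)` dominates as `p → 0`. It pushes
`v` towards the zero of its last factor at a rate of at least `1 / p`. -/
lemma profileField_stiff {σ μ ρ lo Vm vm η : ℝ} (hσ : 1 < σ) (hμ : 1 < μ)
    (hlo : 0 < lo) (hη : 0 < η) :
    ∀ᶠ p in 𝓝[>] (0 : ℝ), ∀ V v, lo ≤ V → V ≤ Vm → 1 / 2 ≤ v → v ≤ vm →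
      ((σ + 1) / 2 * V - σ / 2 * (p + ρ) * v ≤ -η → profileField σ μ ρ p V v ≤ -p⁻¹) ∧
      (η ≤ (σ + 1) / 2 * V - σ / 2 * (p + ρ) * v → p⁻¹ ≤ profileField σ μ ρ p V v) := by
  have hσ1 : 0 < σ - 1 := by linarith
  have hc : 0 < σ + 2 * μ - 2 := by linarith
  have hlim : Tendsto (fun p : ℝ => (lo * p⁻¹) ^ (σ - 1)) (𝓝[>] 0) atTop :=
    (tendsto_rpow_atTop hσ1).comp
      (tendsto_inv_nhdsGT_zero.const_mul_atTop hlo)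
  filter_upwards [hlim.eventually_ge_atTop
    (2 * ((1 + σ) * vm + μ * Vm + 2 * Vm) / ((σ + 2 * μ - 2) * η)),
    Ioc_mem_nhdsGT (show (0 : ℝ) < 1 by norm_num)] with p hR hp V v hV hV' hv hv'
  have hp0 := hp.1
  have hV0 : 0 < V := hlo.trans_le hV
  have hv0 : 0 < v := by linarith
  have hR' : (lo * p⁻¹) ^ (σ - 1) ≤ (V / p) ^ (σ - 1) := by
    refine Real.rpow_le_rpow (by positivity) ?_ hσ1.le
    rw [← div_eq_mul_inv]
    exact div_le_div_of_nonneg_right hV hp0.le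
  have hQ : 2 * ((1 + σ) * vm + μ * Vm + 2 * Vm)
      ≤ (σ + 2 * μ - 2) * (V / p) ^ (σ - 1) * η := by
    have := (div_le_iff₀ (mul_pos hc hη)).1 (hR.trans hR')
    linarith
  obtain ⟨R, hRdef⟩ : ∃ R, R = (σ + 2 * μ - 2) * (V / p) ^ (σ - 1) := ⟨_, rfl⟩
  have hR0 : 0 < R := by rw [hRdef]; positivity
  rw [profileField_eq hp0 hV0, ← hRdef]
  rw [← hRdef] at hQ
  have hvp : v * p ≤ vm := by nlinarith [hp.2]
  have hvp0 : 0 < v * p := by positivity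
  have hRη : (1 + σ) * vm + μ * Vm + 2 * Vm ≤ R * v * η := by
    have : 0 < R * η := by positivity
    nlinarith
  have hμV : μ * V ≤ μ * Vm := by gcongr
  have hμV0 : 0 < μ * V := by positivity
  have hpV : 0 < p * V := by positivity
  have e1 : p⁻¹ = v / (p * V) * (V / v) := by field_simp
  have e2 : V / v ≤ 2 * Vm := by
    rw [div_le_iff₀ hv0]; nlinarith
  have h1 : (1 - σ / 2) * v * p ≤ (1 + σ) * vm := by nlinarith
  have h2 : -((1 + σ) * vm) ≤ (1 - σ / 2) * v * p := by nlinarith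
  have hVm : 0 < Vm := by linarith
  refine ⟨fun hB => ?_, fun hB => ?_⟩
  · rw [e1, ← mul_neg]
    refine mul_le_mul_of_nonneg_left ?_ (by positivity)
    have : R * v * ((σ + 1) / 2 * V - σ / 2 * (p + ρ) * v) ≤ R * v * (-η) := by gcongr
    linarith
  · rw [e1]
    refine mul_le_mul_of_nonneg_left ?_ (by positivity)
    have : R * v * η ≤ R * v * ((σ + 1) / 2 * V - σ / 2 * (p + ρ) * v) := by gcongr
    linarith

open Topology in
/-- The trapped orbit of the profile equation on `(0, ∞)` and its behaviour at `0`. -/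
theorem exists_profile_orbit {σ μ ρ : ℝ} (hσ : 1 < σ) (hμ : 1 < μ) (hρ : 0 < ρ) :
    ∃ (V v : ℝ → ℝ) (w₀ V₀ : ℝ), 0 < w₀ ∧ 0 < V₀ ∧
      (∀ p > 0, HasDerivAt V (v p) p ∧
        HasDerivAt v (profileField σ μ ρ p (V p) (v p)) p ∧
        p ≤ V p ∧ V p ≤ p + ρ * σ / (σ - 1) ∧ w₀ ≤ v p) ∧
      Tendsto V (𝓝[>] 0) (𝓝 V₀) ∧
      Tendsto v (𝓝[>] 0) (𝓝 ((σ + 1) * V₀ / (σ * ρ))) := by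
  obtain ⟨w₀, p₁, htrap⟩ := exists_isTrapping hσ hμ hρ
  obtain ⟨U, v, hUv⟩ := htrap.exists_global
  have hσ1 : 0 < σ - 1 := by linarith
  obtain ⟨hi, hhi⟩ : ∃ hi, hi = ρ * σ / (σ - 1) := ⟨_, rfl⟩
  obtain ⟨vm, hvm⟩ : ∃ vm, vm = (σ + 1) / (σ - 1) := ⟨_, rfl⟩
  rw [← hhi, ← hvm] at hUv
  have hvm0 : 0 < vm := by rw [hvm]; positivity
  set V : ℝ → ℝ := fun p => p + U p with hVdef
  have hV : ∀ p > 0, HasDerivAt V (v p) p := by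
    intro p hp
    have := (hasDerivAt_id p).add (hUv p hp).1
    rwa [add_sub_cancel] at this
  have hw₀ := htrap.w₀_pos
  have hmono : MonotoneOn V (Ioo 0 1) := by
    refine monotoneOn_of_hasDerivWithinAt_nonneg (f' := v) (convex_Ioo _ _)
      (fun p hp => (hV p hp.1).continuousAt.continuousWithinAt)
      (fun p hp => (hV p (interior_subset hp).1).hasDerivWithinAt) ?_
    intro p hp
    exact hw₀.le.trans (hUv p (interior_subset hp).1).2.2.2.1.1
  have hlow : ∀ p > 0, ρ / 2 ≤ V p := fun p hp => by
    have := (hUv p hp).2.2.1.1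
    simp only [hVdef]; linarith
  have hbdd : BddBelow (V '' Ioo 0 1) := by
    refine ⟨ρ / 2, ?_⟩
    rintro _ ⟨p, hp, rfl⟩
    exact hlow p hp.1
  have hlimV := hmono.tendsto_nhdsWithin_Ioo_right ⟨1 / 2, by norm_num, by norm_num⟩ hbdd
  set V₀ := sInf (V '' Ioo 0 1)
  have hV₀V : ∀ p ∈ Ioo (0 : ℝ) 1, V₀ ≤ V p := fun p hp => csInf_le hbdd ⟨p, hp, rfl⟩
  have hV₀pos : 0 < V₀ := by
    have : ρ / 2 ≤ V₀ := ge_of_tendsto hlimV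
      (eventually_mem_nhdsWithin.mono fun p hp => hlow p hp)
    linarith
  refine ⟨V, v, w₀, V₀, hw₀, hV₀pos, fun p hp => ⟨hV p hp, (hUv p hp).2.1, ?_, ?_,
    (hUv p hp).2.2.2.1.1⟩, hlimV, ?_⟩
  · have := (hUv p hp).2.2.1.1
    simp only [hVdef]; linarith
  · have := (hUv p hp).2.2.1.2
    rw [← hhi]; simp only [hVdef]; linarith
  obtain ⟨l, hl⟩ : ∃ l, l = (σ + 1) * V₀ / (σ * ρ) := ⟨_, rfl⟩
  have hlV : σ * ρ * l = (σ + 1) * V₀ := by rw [hl]; field_simp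
  rw [← hl]
  have key : ∀ δ > 0, ∀ᶠ p in 𝓝[>] (0 : ℝ), v p ≤ l + δ ∧ l - δ ≤ v p := by
    intro δ hδ
    have hη : 0 < σ * ρ * δ / 4 := by positivity
    have hev := profileField_stiff (ρ := ρ) (lo := ρ / 2) (Vm := 1 + hi) (vm := vm) hσ hμ
      (by positivity) hη
    have hcl : ∀ᶠ p in 𝓝[>] (0 : ℝ), V p < V₀ + σ * ρ * δ / (2 * (σ + 1)) :=
      hlimV.eventually (gt_mem_nhds (by
        have : 0 < σ * ρ * δ / (2 * (σ + 1)) := by positivity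
        linarith))
    obtain ⟨q, hq, hqs⟩ := (mem_nhdsGT_iff_exists_Ioc_subset).1 (hev.and (hcl.and
      (Ioc_mem_nhdsGT (show 0 < min (min p₁ (1 / 2)) (ρ * δ / (2 * vm)) from
        lt_min (lt_min htrap.p₁_pos (by norm_num)) (by positivity)))))
    have hq : 0 < q := hq
    have hfacts : ∀ p ∈ Ioc 0 q, p ≤ p₁ ∧ p < 1 ∧ p * vm ≤ ρ * δ / 2 ∧ V p ≤ 1 + hi ∧
        1 / 2 ≤ v p ∧ v p ≤ vm ∧ V₀ ≤ V p ∧ V p < V₀ + σ * ρ * δ / (2 * (σ + 1)) ∧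
        (l + δ ≤ v p → profileField σ μ ρ p (V p) (v p) ≤ -p⁻¹) ∧
        (v p ≤ l - δ → p⁻¹ ≤ profileField σ μ ρ p (V p) (v p)) := by
      intro p hp
      obtain ⟨h1, h2, h3⟩ := hqs hp
      have h4 : p ≤ p₁ := h3.2.trans ((min_le_left _ _).trans (min_le_left _ _))
      have h5 : p ≤ 1 / 2 := h3.2.trans ((min_le_left _ _).trans (min_le_right _ _))
      have h6 : p ≤ ρ * δ / (2 * vm) := h3.2.trans (min_le_right _ _)
      have h7 : p * vm ≤ ρ * δ / 2 := by
        rw [le_div_iff₀ (by positivity)] at h6; linarith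
      have h8 : V p ≤ 1 + hi := by
        have := (hUv p hp.1).2.2.1.2
        simp only [hVdef]; linarith
      have h9 := (hUv p hp.1).2.2.2.2 h4
      have h10 := (hUv p hp.1).2.2.2.1.2
      have h11 := hV₀V p ⟨hp.1, by linarith⟩
      obtain ⟨hA, hB⟩ := h1 (V p) (v p) (hlow p hp.1) h8 h9 h10
      refine ⟨h4, by linarith, h7, h8, h9, h10, h11, h2, fun h => hA ?_, fun h => hB ?_⟩
      · have h12 : (σ + 1) * (V p - V₀) ≤ σ * ρ * δ / 2 := by
          have h13 : (σ + 1) * (V p - V₀) ≤ (σ + 1) * (σ * ρ * δ / (2 * (σ + 1))) := by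
            gcongr; linarith
          refine h13.trans_eq ?_
          field_simp
        have h14 : σ * ρ * (l + δ) ≤ σ * (p + ρ) * v p := by
          have hp0 := hp.1
          have h15 : σ * ρ * (l + δ) ≤ σ * ρ * v p := by gcongr
          have h16 : 0 ≤ σ * p * v p := mul_nonneg (by positivity) (by linarith)
          linarith
        linarith
      · have h12 : σ * ρ * v p ≤ σ * ρ * (l - δ) := by gcongr
        have h13 : σ * (p * v p) ≤ σ * (ρ * δ / 2) := by
          have : p * v p ≤ p * vm := mul_le_mul_of_nonneg_left h10 hp.1.le
          gcongr
          linarith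
        have h14 : (σ + 1) * V₀ ≤ (σ + 1) * V p := by gcongr
        linarith
    have hIoc : ∀ᶠ p in 𝓝[>] (0 : ℝ), p ∈ Ioc 0 q := Ioc_mem_nhdsGT hq
    refine hIoc.mono fun p hp => ⟨?_, ?_⟩
    · have := nonpos_of_deriv_le_neg_inv (w := fun p => v p - (l + δ)) (C := vm - (l + δ))
        (fun p hp => ((hUv p hp.1).2.1).sub_const _)
        (fun p hp h => (hfacts p hp).2.2.2.2.2.2.2.2.1 (by linarith))
        (fun p hp => by linarith [(hfacts p hp).2.2.2.2.2.1]) p hp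
      linarith
    · have := nonpos_of_deriv_le_neg_inv (w := fun p => (l - δ) - v p) (C := l - δ)
        (fun p hp => ((hUv p hp.1).2.1).const_sub _)
        (fun p hp h => neg_le_neg ((hfacts p hp).2.2.2.2.2.2.2.2.2 (by linarith)))
        (fun p hp => by linarith [(hfacts p hp).2.2.2.2.1]) p hp
      linarith
  rw [Metric.tendsto_nhds]
  intro δ hδ
  filter_upwards [key (δ / 2) (by linarith)] with p hp
  rw [Real.dist_eq, abs_lt]
  exact ⟨by linarith [hp.2], by linarith [hp.1]⟩

/-! ### Inversion: the pressure as a function of the similarity variable -/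

/-- Passing from `V(p)` to the similarity variable `X = A * V ^ (σ / 2)`: the algebraic identity
between `V'' = profileField` and the profile equation in terms of `p = p(z)`. Here
`V / (σ / 2 * X * v)` stands for `dp / dz`, and its product with the preceding factor for
`d²p / dz²`. -/
lemma profile_identity {m σ μ ρ p V v A X : ℝ} (hm : 0 < m) (hσ : 1 < σ) (hμ : 1 < μ)
    (hp : 0 < p) (hV : 0 < V)
    (hv : 0 < v) (hX : 0 < X) (hA : A ^ 2 = 2 * m * (σ + 2 * μ - 2) / σ)
    (hXV : X ^ 2 = A ^ 2 * V ^ σ) :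
    m * p ^ σ * ((v ^ 2 - σ / 2 * v ^ 2 - V * profileField σ μ ρ p V v) / (σ / 2 * X * v ^ 2)
        * (V / (σ / 2 * X * v)))
      = m * μ * p ^ (σ - 1) * (V / (σ / 2 * X * v)) ^ 2 + p + ρ
        - (σ + 1) / 2 * X * (V / (σ / 2 * X * v)) := by
  have h1 : p ^ (σ - 1) = p ^ σ / p := Real.rpow_sub_one hp.ne' σ
  have h2 : V ^ (σ - 2) = V ^ σ / V ^ 2 := by
    rw [Real.rpow_sub hV, show (2 : ℝ) = ((2 : ℕ) : ℝ) by norm_num, Real.rpow_natCast]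
  have h3 : p ^ (-σ) = (p ^ σ)⁻¹ := Real.rpow_neg hp.le σ
  have hpσ : 0 < p ^ σ := Real.rpow_pos_of_pos hp σ
  have hVσ : 0 < V ^ σ := Real.rpow_pos_of_pos hV σ
  have hσ0 : 0 < σ := by linarith
  obtain ⟨c, hc⟩ : ∃ c, c = σ + 2 * μ - 2 := ⟨_, rfl⟩
  have hc0 : 0 < c := by linarith
  rw [profileField, h1, h2, h3]
  rw [← hc] at hA ⊢
  generalize p ^ σ = a at *
  generalize V ^ σ = b at *
  have hX2 : X ^ 2 = 2 * m * c * b / σ := by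
    rw [hXV, hA]; field_simp
  have e1 : ∀ N : ℝ, N / (σ / 2 * X * v ^ 2) * (V / (σ / 2 * X * v))
      = 4 * N * V / (σ ^ 2 * X ^ 2 * v ^ 3) := by
    intro N; field_simp; norm_num
  have e2 : (V / (σ / 2 * X * v)) ^ 2 = 4 * V ^ 2 / (σ ^ 2 * X ^ 2 * v ^ 2) := by
    field_simp; norm_num
  have e3 : (σ + 1) / 2 * X * (V / (σ / 2 * X * v)) = (σ + 1) * V / (σ * v) := by
    field_simp
  rw [e1, e2, e3, hX2]
  field_simp
  rw [hc]
  ring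

/-- `P`, with first and second derivatives `P₁` and `P₂`, solves on `(z₀, ∞)` the equation satisfied
by `φ ^ (1 - β)` when `φ` is a profile; it vanishes at `z₀` with the slope dictated by the equation
and is pinned between two curves of order `z ^ (2 / σ)` at infinity. The parameters are
`σ = (1 - m) / (β - 1)`, `μ = 1 + m / (β - 1)` and `ρ = r * (β - 1)`; the amplitude `A` and the
constants `hi` and `K` enter the bounds at infinity. -/
structure IsPressureProfile (m σ μ ρ A z₀ K hi : ℝ) (P P₁ P₂ : ℝ → ℝ) : Prop where
  z₀_pos : 0 < z₀
  K_pos : 0 < K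
  hi_pos : 0 < hi
  pos : ∀ z ∈ Ioi z₀, 0 < P z
  deriv_pos : ∀ z ∈ Ioi z₀, 0 < P₁ z
  hasDerivAt : ∀ z ∈ Ioi z₀, HasDerivAt P (P₁ z) z
  hasDerivAt_deriv : ∀ z ∈ Ioi z₀, HasDerivAt P₁ (P₂ z) z
  ode : ∀ z ∈ Ioi z₀, m * P z ^ σ * P₂ z = m * μ * P z ^ (σ - 1) * P₁ z ^ 2 + P z + ρ
    - (σ + 1) / 2 * z * P₁ z
  le_self : ∀ z ∈ Ioi z₀, A * P z ^ (σ / 2) ≤ z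
  self_le : ∀ z ∈ Ioi z₀, z ≤ A * (P z + hi) ^ (σ / 2)
  mul_deriv_le : ∀ z ∈ Ioi z₀, z * P₁ z ≤ K * (P z + hi)
  tendsto : Tendsto P (nhdsWithin z₀ (Ioi z₀)) (nhds 0)
  tendsto_deriv : Tendsto P₁ (nhdsWithin z₀ (Ioi z₀)) (nhds (2 * ρ / ((σ + 1) * z₀)))

open Topology in
/-- Existence of a pressure profile: invert `p ↦ X(p) = A * V(p) ^ (σ / 2)`, where `V` is the trapped
orbit. -/
theorem exists_isPressureProfile {m σ μ ρ A : ℝ} (hm : 0 < m) (hσ : 1 < σ) (hμ : 1 < μ)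
    (hρ : 0 < ρ) (hA0 : 0 < A) (hA : A ^ 2 = 2 * m * (σ + 2 * μ - 2) / σ) :
    ∃ (z₀ K hi : ℝ) (P P₁ P₂ : ℝ → ℝ), IsPressureProfile m σ μ ρ A z₀ K hi P P₁ P₂ := by
  obtain ⟨V, v, w₀, V₀, hw₀, hV₀, horb, hlimV, hlimv⟩ := exists_profile_orbit hσ hμ hρ
  have hσ0 : 0 < σ := by linarith
  have hσ1 : 0 < σ - 1 := by linarith
  obtain ⟨hi, hhi⟩ : ∃ hi, hi = ρ * σ / (σ - 1) := ⟨_, rfl⟩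
  have hhi0 : 0 < hi := by rw [hhi]; positivity
  rw [← hhi] at horb
  have hVpos : ∀ p > 0, 0 < V p := fun p hp => lt_of_lt_of_le hp (horb p hp).2.2.1
  have hvpos : ∀ p > 0, 0 < v p := fun p hp => hw₀.trans_le (horb p hp).2.2.2.2
  set X : ℝ → ℝ := fun p => A * V p ^ (σ / 2) with hXdef
  have hXpos : ∀ p > 0, 0 < X p := fun p hp => mul_pos hA0 (Real.rpow_pos_of_pos (hVpos p hp) _)
  have hX' : ∀ p > 0, HasDerivAt X (σ / 2 * X p * v p / V p) p := by
    intro p hp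
    have h1 := ((horb p hp).1.rpow_const (p := σ / 2) (Or.inl (hVpos p hp).ne')).const_mul A
    refine h1.congr_deriv ?_
    rw [Real.rpow_sub_one (hVpos p hp).ne']
    simp only [hXdef]
    ring
  have hX'pos : ∀ p > 0, 0 < σ / 2 * X p * v p / V p := fun p hp => by
    have := hXpos p hp
    have := hVpos p hp
    have := hvpos p hp
    positivity
  have hXmono : StrictMonoOn X (Ioi 0) := by
    refine strictMonoOn_of_hasDerivWithinAt_pos (f' := fun p => σ / 2 * X p * v p / V p)
      (convex_Ioi 0)
      (fun p hp => (hX' p hp).continuousAt.continuousWithinAt) ?_ ?_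
    · intro p hp
      exact (hX' p (interior_subset hp)).hasDerivWithinAt
    · intro p hp
      exact hX'pos p (interior_subset hp)
  have hXlow : ∀ p > 0, A * p ^ (σ / 2) ≤ X p := fun p hp => by
    have := (horb p hp).2.2.1
    simp only [hXdef]
    gcongr
  have hXup : ∀ p > 0, X p ≤ A * (p + hi) ^ (σ / 2) := fun p hp => by
    have := (horb p hp).2.2.2.1
    have := hVpos p hp
    simp only [hXdef]
    gcongr
  obtain ⟨z₀, hz₀⟩ : ∃ z₀, z₀ = A * V₀ ^ (σ / 2) := ⟨_, rfl⟩
  have hz₀pos : 0 < z₀ := by rw [hz₀]; positivity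
  have hXlim : Tendsto X (𝓝[>] 0) (𝓝 z₀) := by
    rw [hz₀]
    exact (hlimV.rpow_const (Or.inl hV₀.ne')).const_mul A
  have hXz₀ : ∀ p > 0, z₀ < X p := by
    intro p hp
    have h1 : z₀ ≤ X (p / 2) := by
      refine le_of_tendsto hXlim ?_
      filter_upwards [Ioc_mem_nhdsGT (half_pos hp)] with t ht
      exact hXmono.monotoneOn ht.1 (half_pos hp) ht.2
    exact h1.trans_lt (hXmono (half_pos hp) hp (half_lt_self hp))
  have hXtop : Tendsto X atTop atTop := by
    refine tendsto_atTop_mono' atTop ((eventually_gt_atTop 0).mono hXlow) ?_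
    exact (tendsto_rpow_atTop (by linarith : 0 < σ / 2)).const_mul_atTop hA0
  have hsurj : ∀ z : ℝ, ∃ p : ℝ, z₀ < z → 0 < p ∧ X p = z := by
    intro z
    by_cases hz : z₀ < z
    · obtain ⟨a, haz, ha⟩ := ((hXlim.eventually (gt_mem_nhds hz)).and
        self_mem_nhdsWithin).exists
      have ha : 0 < a := ha
      obtain ⟨b, hbz, hb⟩ := ((hXtop.eventually_ge_atTop z).and (eventually_ge_atTop a)).exists
      obtain ⟨p, hp, hpz⟩ := intermediate_value_Icc hb
        (fun t ht => (hX' t (ha.trans_le ht.1)).continuousAt.continuousWithinAt)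
        (show z ∈ Icc (X a) (X b) from ⟨haz.le, hbz⟩)
      exact ⟨p, fun _ => ⟨ha.trans_le hp.1, hpz⟩⟩
    · exact ⟨0, fun h => absurd h hz⟩
  choose P hP using hsurj
  have hPX : ∀ p > 0, P (X p) = p := fun p hp =>
    hXmono.injOn (hP _ (hXz₀ p hp)).1 hp (hP _ (hXz₀ p hp)).2
  have hPmono : StrictMonoOn P (Ioi z₀) := by
    intro y hy z hz hyz
    by_contra! hle
    have := hXmono.monotoneOn (hP z hz).1 (hP y hy).1 hle
    rw [(hP z hz).2, (hP y hy).2] at this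
    linarith
  have hPimage : P '' Ioi z₀ = Ioi 0 := by
    ext p
    constructor
    · rintro ⟨z, hz, rfl⟩
      exact (hP z hz).1
    · exact fun hp => ⟨X p, hXz₀ p hp, hPX p hp⟩
  have hPcont : ∀ z > z₀, ContinuousAt P z := by
    intro z hz
    refine hPmono.continuousAt_of_image_mem_nhds (Ioi_mem_nhds hz) ?_
    rw [hPimage]
    exact Ioi_mem_nhds (hP z hz).1
  obtain ⟨q, hq⟩ : ∃ q : ℝ → ℝ, q = fun p => V p / (σ / 2 * X p * v p) := ⟨_, rfl⟩
  have hP' : ∀ z > z₀, HasDerivAt P (q (P z)) z := by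
    intro z hz
    have hp := (hP z hz).1
    have := HasDerivAt.of_local_left_inverse (hPcont z hz) (hX' _ hp) (hX'pos _ hp).ne'
      ((eventually_gt_nhds hz).mono fun y hy => (hP y hy).2)
    rwa [inv_div, ← show q (P z) = _ from congrFun hq (P z)] at this
  have hq' : ∀ p > 0, HasDerivAt q ((v p ^ 2 - σ / 2 * v p ^ 2
      - V p * profileField σ μ ρ p (V p) (v p)) / (σ / 2 * X p * v p ^ 2)) p := by
    intro p hp
    have hXp := hXpos p hp
    have hVp := hVpos p hp
    have hvp := hvpos p hp
    have h1 := (horb p hp).1.div (((hX' p hp).const_mul (σ / 2)).mul (horb p hp).2.1)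
      (mul_pos (mul_pos (half_pos hσ0) hXp) hvp).ne'
    rw [hq]
    refine h1.congr_deriv ?_
    simp only [Pi.mul_apply]
    field_simp
    ring
  have hP₁' : ∀ z > z₀, HasDerivAt (fun z => q (P z)) ((v (P z) ^ 2 - σ / 2 * v (P z) ^ 2
      - V (P z) * profileField σ μ ρ (P z) (V (P z)) (v (P z))) / (σ / 2 * X (P z) * v (P z) ^ 2)
      * q (P z)) z := fun z hz => (hq' _ (hP z hz).1).comp z (hP' z hz)
  have hPlim : Tendsto P (𝓝[>] z₀) (𝓝[>] 0) := by
    refine tendsto_nhdsWithin_iff.2 ⟨?_, eventually_mem_nhdsWithin.mono fun z hz => (hP z hz).1⟩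
    rw [Metric.tendsto_nhds]
    intro ε hε
    filter_upwards [Ioo_mem_nhdsGT (hXz₀ ε hε)] with z hz
    have h1 := hPmono hz.1 (hXz₀ ε hε) hz.2
    rw [hPX ε hε] at h1
    rw [Real.dist_eq, sub_zero, abs_of_pos (hP z hz.1).1]
    exact h1
  have hcv : ∀ z ∈ Ioi z₀, 0 < z ∧ 0 < P z ∧ X (P z) = z ∧ 0 < V (P z) ∧ 0 < v (P z) :=
    fun z hz => ⟨hz₀pos.trans hz, (hP z hz).1, (hP z hz).2, hVpos _ (hP z hz).1,
      hvpos _ (hP z hz).1⟩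
  refine ⟨z₀, 1 / (σ / 2 * w₀), hi, P, fun z => q (P z),
    fun z => (v (P z) ^ 2 - σ / 2 * v (P z) ^ 2
      - V (P z) * profileField σ μ ρ (P z) (V (P z)) (v (P z))) / (σ / 2 * X (P z) * v (P z) ^ 2)
      * q (P z),
    { z₀_pos := hz₀pos
      K_pos := by positivity
      hi_pos := hhi0
      pos := fun z hz => (hP z hz).1
      deriv_pos := fun z hz => ?_
      hasDerivAt := hP'
      hasDerivAt_deriv := hP₁'
      ode := fun z hz => ?_
      le_self := fun z hz => (hXlow _ (hP z hz).1).trans_eq (hP z hz).2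
      self_le := fun z hz => (hP z hz).2.symm.trans_le (hXup _ (hP z hz).1)
      mul_deriv_le := fun z hz => ?_
      tendsto := hPlim.mono_right nhdsWithin_le_nhds
      tendsto_deriv := ?_ }⟩
  · obtain ⟨hz0, hp, hXz, hVp, hvp⟩ := hcv z hz
    simp only [hq, hXz]
    positivity
  · obtain ⟨hz0, hp, hXz, hVp, hvp⟩ := hcv z hz
    have hXV : X (P z) ^ 2 = A ^ 2 * V (P z) ^ σ := by
      simp only [hXdef]
      rw [mul_pow, ← Real.rpow_natCast (V (P z) ^ (σ / 2)), ← Real.rpow_mul hVp.le]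
      congr 2
      push_cast
      ring
    have := profile_identity hm hσ hμ (ρ := ρ) hp hVp hvp (hXpos _ hp) hA hXV
    rw [hq]
    rw [hXz] at this
    simpa only [hXz] using this
  · obtain ⟨hz0, hp, hXz, hVp, hvp⟩ := hcv z hz
    have h1 : z * q (P z) = V (P z) / (σ / 2 * v (P z)) := by
      simp only [hq, hXz]
      field_simp
    rw [h1, one_div, inv_mul_eq_div]
    exact div_le_div₀ (by linarith) (horb _ hp).2.2.2.1 (by positivity)
      (mul_le_mul_of_nonneg_left (horb _ hp).2.2.2.2 (by linarith))
  · have hqlim : Tendsto q (𝓝[>] 0) (𝓝 (2 * ρ / ((σ + 1) * z₀))) := by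
      have hl0 : 0 < (σ + 1) * V₀ / (σ * ρ) := by positivity
      have := hlimV.div ((hXlim.const_mul (σ / 2)).mul hlimv) (by positivity)
      have hval : V₀ / (σ / 2 * z₀ * ((σ + 1) * V₀ / (σ * ρ))) = 2 * ρ / ((σ + 1) * z₀) := by
        field_simp
      rw [hval] at this
      rw [hq]
      exact this
    exact hqlim.comp hPlim

/-! ### From the pressure back to the profile -/

section PressurePowers

variable {I : Set ℝ} {P P₁ P₂ : ℝ → ℝ}

lemma hasDerivAt_rpow_pressure (hpos : ∀ z ∈ I, 0 < P z)
    (h1 : ∀ z ∈ I, HasDerivAt P (P₁ z) z) (e : ℝ) :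
    ∀ z ∈ I, HasDerivAt (fun y => P y ^ e) (e * P z ^ (e - 1) * P₁ z) z := fun z hz => by
  have := (h1 z hz).rpow_const (p := e) (Or.inl (hpos z hz).ne')
  exact this.congr_deriv (by ring)

open Topology in
lemma hasDerivAt_deriv_rpow_pressure (hI : IsOpen I) (hpos : ∀ z ∈ I, 0 < P z)
    (h1 : ∀ z ∈ I, HasDerivAt P (P₁ z) z) (h2 : ∀ z ∈ I, HasDerivAt P₁ (P₂ z) z) (e : ℝ) :
    ∀ z ∈ I, HasDerivAt (deriv fun y => P y ^ e)
      (e * (e - 1) * P z ^ (e - 2) * P₁ z ^ 2 + e * P z ^ (e - 1) * P₂ z) z := fun z hz => by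
  have hev : (deriv fun y => P y ^ e) =ᶠ[𝓝 z] fun y => e * P y ^ (e - 1) * P₁ y := by
    filter_upwards [hI.mem_nhds hz] with y hy
    exact (hasDerivAt_rpow_pressure hpos h1 e y hy).deriv
  have h3 := ((hasDerivAt_rpow_pressure hpos h1 (e - 1) z hz).const_mul e).mul (h2 z hz)
  refine (h3.congr_deriv ?_).congr_of_eventuallyEq hev
  rw [show e - 1 - 1 = e - 2 by ring]
  ring

lemma contDiffOn_two_of_hasDerivAt (hI : IsOpen I) (h1 : ∀ z ∈ I, HasDerivAt P (P₁ z) z)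
    (h2 : ∀ z ∈ I, HasDerivAt P₁ (P₂ z) z) (hc : ContinuousOn P₂ I) : ContDiffOn ℝ 2 P I := by
  have hP₁ : ContDiffOn ℝ 1 P₁ I := by
    rw [show (1 : WithTop ℕ∞) = 0 + 1 by norm_num, contDiffOn_succ_iff_deriv_of_isOpen hI]
    refine ⟨fun z hz => (h2 z hz).differentiableAt.differentiableWithinAt, by simp, ?_⟩
    exact contDiffOn_zero.2 (hc.congr fun z hz => (h2 z hz).deriv)
  rw [show (2 : WithTop ℕ∞) = 1 + 1 by norm_num, contDiffOn_succ_iff_deriv_of_isOpen hI]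
  refine ⟨fun z hz => (h1 z hz).differentiableAt.differentiableWithinAt, by simp, ?_⟩
  exact hP₁.congr fun z hz => (h1 z hz).deriv

open Topology in
/-- If `P` solves the equation for `φ ^ (1 - β)`, then `φ = P ^ (-1 / (β - 1))` solves the profile
equation. -/
lemma isProfileSolutionOn_rpow_pressure {m β r a σ μ : ℝ} (hm : 0 < m)
    (ha : a * (β - 1) = 1) (hσ : σ = a * (1 - m)) (hμ : μ = m * a + 1)
    (hI : IsOpen I) (hpos : ∀ z ∈ I, 0 < P z)
    (h1 : ∀ z ∈ I, HasDerivAt P (P₁ z) z) (h2 : ∀ z ∈ I, HasDerivAt P₁ (P₂ z) z)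
    (hode : ∀ z ∈ I, m * P z ^ σ * P₂ z = m * μ * P z ^ (σ - 1) * P₁ z ^ 2 + P z + r * (β - 1)
      - (σ + 1) / 2 * z * P₁ z) :
    IsProfileSolutionOn m β r (fun z => P z ^ (-a)) I := by
  have hβ0 : β - 1 ≠ 0 := right_ne_zero_of_mul_eq_one ha
  have ha' : a = 1 / (β - 1) := eq_one_div_of_mul_eq_one_left ha
  refine ⟨?_, fun z hz => Real.rpow_pos_of_pos (hpos z hz) _, fun z hz => ?_⟩
  · have hPcd : ContDiffOn ℝ 2 P I := by
      refine contDiffOn_two_of_hasDerivAt hI h1 h2 ?_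
      have hPc : ContinuousOn P I := fun z hz => (h1 z hz).continuousAt.continuousWithinAt
      have hP₁c : ContinuousOn P₁ I := fun z hz => (h2 z hz).continuousAt.continuousWithinAt
      have hcont : ContinuousOn (fun z => (m * μ * P z ^ (σ - 1) * P₁ z ^ 2 + P z + r * (β - 1)
          - (σ + 1) / 2 * z * P₁ z) / (m * P z ^ σ)) I := by
        refine ContinuousOn.div ?_ ?_ ?_
        · refine ((((continuousOn_const.mul (hPc.rpow_const ?_)).mul (hP₁c.pow 2)).add hPc).add
            continuousOn_const).sub ((continuousOn_const.mul continuousOn_id).mul hP₁c)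
          exact fun z hz => Or.inl (hpos z hz).ne'
        · exact continuousOn_const.mul (hPc.rpow_const fun z hz => Or.inl (hpos z hz).ne')
        · exact fun z hz => (mul_pos hm (Real.rpow_pos_of_pos (hpos z hz) _)).ne'
      refine hcont.congr fun z hz => ?_
      have := Real.rpow_pos_of_pos (hpos z hz) σ
      rw [eq_div_iff (by positivity), ← hode z hz]
      ring
    exact hPcd.rpow_const_of_ne fun z hz => (hpos z hz).ne'
  · have hp := hpos z hz
    have hd1 : deriv (fun z => P z ^ (-a)) z = -a * P z ^ (-a - 1) * P₁ z :=
      (hasDerivAt_rpow_pressure hpos h1 (-a) z hz).deriv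
    have hev : (fun y => (P y ^ (-a)) ^ m) =ᶠ[𝓝 z] fun y => P y ^ (-(a * m)) := by
      filter_upwards [hI.mem_nhds hz] with y hy
      rw [← Real.rpow_mul (hpos y hy).le]
      congr 1; ring
    have hd2 : deriv (deriv fun y => (P y ^ (-a)) ^ m) z = _ :=
      (hev.deriv.deriv_eq).trans
        (hasDerivAt_deriv_rpow_pressure hI hpos h1 h2 (-(a * m)) z hz).deriv
    rw [hd1, hd2]
    have e1 : P z ^ (-a) = P z ^ (-a - 1) * P z := by
      rw [← Real.rpow_add_one hp.ne']; congr 1; ring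
    have e2 : (P z ^ (-a)) ^ β = P z ^ (-a - 1) := by
      rw [← Real.rpow_mul hp.le]; congr 1; linear_combination -ha
    have e3 : P z ^ (-(a * m) - 1) = P z ^ (-a - 1) * P z ^ σ := by
      rw [← Real.rpow_add hp]; congr 1; rw [hσ]; ring
    have e4 : P z ^ (-(a * m) - 2) = P z ^ (-a - 1) * P z ^ (σ - 1) := by
      rw [← Real.rpow_add hp]; congr 1; rw [hσ]; ring
    beta_reduce
    rw [e2, e3, e4, e1, ← ha']
    have hode' := hode z hz
    generalize P z ^ (-a - 1) = g at *
    generalize P z ^ (σ - 1) = u at *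
    generalize P z ^ σ = w at *
    have hσ1 : a * (β - m) = σ + 1 := by rw [hσ]; linear_combination ha
    rw [hμ] at hode'
    linear_combination (g * a) * hode' + (g * a * z * P₁ z / 2) * hσ1 + r * g * ha

end PressurePowers

open Topology in
/-- The pure power `C / z ^ (2 / (1 - m))` with `C ^ (1 - m) = 2 m (1 + m) / (1 - m)` solves the
profile equation without reaction. -/
lemma isProfileSolutionOn_power {m β C : ℝ} (hm0 : 0 < m) (hm1 : m < 1) (hβ : 1 < β) (hC : 0 < C)
    (hCm : C ^ (1 - m) = 2 * m * (1 + m) / (1 - m)) :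
    IsProfileSolutionOn m β 0 (fun z => C / z ^ (2 / (1 - m))) (Ioi 0) := by
  have h1m : 0 < 1 - m := by linarith
  have hβ1 : 0 < β - 1 := by linarith
  -- write the power as `P ^ (-a)` with `P` itself a power
  obtain ⟨a, ha⟩ : ∃ a, a = 1 / (β - 1) := ⟨_, rfl⟩
  have ha0 : 0 < a := by rw [ha]; positivity
  have ha1 : a * (β - 1) = 1 := by rw [ha]; field_simp
  obtain ⟨σ, hσ⟩ : ∃ σ, σ = a * (1 - m) := ⟨_, rfl⟩
  have hσ0 : 0 < σ := by rw [hσ]; positivity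
  obtain ⟨B, hB⟩ : ∃ B, B = C ^ (-(β - 1)) := ⟨_, rfl⟩
  have hB0 : 0 < B := by rw [hB]; positivity
  have hd : ∀ k : ℝ, ∀ z ∈ Ioi (0 : ℝ), HasDerivAt (fun z : ℝ => z ^ k) (k * z ^ (k - 1)) z :=
    fun k z hz => Real.hasDerivAt_rpow_const (Or.inl (ne_of_gt hz))
  have hsol := isProfileSolutionOn_rpow_pressure (m := m) (β := β) (r := 0) (a := a) (σ := σ)
    (μ := m * a + 1) (I := Ioi 0) (P := fun z => B * z ^ (2 / σ))
    (P₁ := fun z => B * (2 / σ * z ^ (2 / σ - 1)))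
    (P₂ := fun z => B * (2 / σ * ((2 / σ - 1) * z ^ (2 / σ - 1 - 1)))) hm0 ha1 hσ rfl isOpen_Ioi
    (fun z hz => mul_pos hB0 (Real.rpow_pos_of_pos hz _))
    (fun z hz => (hd _ z hz).const_mul B)
    (fun z hz => ((hd _ z hz).const_mul _).const_mul B)
    (fun z hz => by
      have hz : 0 < z := hz
      have hBσ : B ^ σ * (2 * m * (1 + m)) = 1 - m := by
        have : B ^ σ = (C ^ (1 - m))⁻¹ := by
          rw [hB, ← Real.rpow_mul hC.le, ← Real.rpow_neg hC.le, hσ]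
          congr 1
          linear_combination (-(1 - m)) * ha1
        rw [this, hCm]
        field_simp
      have hzk : (z ^ (2 / σ)) ^ σ = z ^ 2 := by
        rw [← Real.rpow_mul hz.le, div_mul_cancel₀ _ hσ0.ne']
        norm_cast
      have hz1 : z ^ (2 / σ - 1) = z ^ (2 / σ) / z := Real.rpow_sub_one hz.ne' _
      have hz2 : z ^ (2 / σ - 1 - 1) = z ^ (2 / σ) / z / z := by
        rw [Real.rpow_sub_one hz.ne', hz1]
      have hu : 0 < z ^ (2 / σ) := Real.rpow_pos_of_pos hz _
      rw [Real.rpow_sub_one (mul_pos hB0 hu).ne' σ, Real.mul_rpow hB0.le hu.le, hzk, hz1, hz2]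
      generalize z ^ (2 / σ) = u at *
      have hma : m * a = σ * m / (1 - m) := by rw [hσ]; field_simp
      rw [hma]
      generalize B ^ σ = b at *
      have hb : b = (1 - m) / (2 * m * (1 + m)) := by
        rw [eq_div_iff (by positivity)]; exact hBσ
      rw [hb]
      field_simp
      ring)
  have heq : EqOn (fun z : ℝ => C / z ^ (2 / (1 - m))) (fun z => (B * z ^ (2 / σ)) ^ (-a))
      (Ioi 0) := by
    intro z hz
    have hz : 0 < z := hz
    simp only
    rw [Real.mul_rpow hB0.le (by positivity), hB, ← Real.rpow_mul hC.le, ← Real.rpow_mul hz.le,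
      show -(β - 1) * -a = 1 by linear_combination ha1, Real.rpow_one,
      show 2 / σ * -a = -(2 / (1 - m)) by rw [hσ]; field_simp, Real.rpow_neg hz.le, div_eq_mul_inv]
  refine ⟨hsol.1.congr heq, fun z hz => (heq hz).symm ▸ hsol.2.1 z hz, fun z hz => ?_⟩
  have hnh : (fun z : ℝ => C / z ^ (2 / (1 - m))) =ᶠ[𝓝 z] fun z => (B * z ^ (2 / σ)) ^ (-a) :=
    heq.eventuallyEq_of_mem (isOpen_Ioi.mem_nhds hz)
  have hnh' : (fun y : ℝ => (C / y ^ (2 / (1 - m))) ^ m) =ᶠ[𝓝 z]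
      fun y => ((B * y ^ (2 / σ)) ^ (-a)) ^ m := hnh.mono fun y hy => by simp only at hy; simp only [hy]
  have := hsol.2.2 z hz
  rw [hnh.deriv_eq, hnh'.deriv.deriv_eq]
  simp only [zero_mul] at this ⊢
  rw [← this, show C / z ^ (2 / (1 - m)) = _ from heq hz]

/-! ### Estimates for the profile -/

open Topology in
lemma nonneg_of_deriv_nonneg_of_tendsto_zero {g g' : ℝ → ℝ} {a b : ℝ}
    (hg : ∀ z ∈ Ioo a b, HasDerivAt g (g' z) z) (hg' : ∀ z ∈ Ioo a b, 0 ≤ g' z)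
    (hlim : Tendsto g (𝓝[>] a) (𝓝 0)) : ∀ z ∈ Ioo a b, 0 ≤ g z := by
  intro z hz
  have hmono : MonotoneOn g (Ioo a b) := by
    refine monotoneOn_of_hasDerivWithinAt_nonneg (f' := g') (convex_Ioo _ _)
      (fun p hp => (hg p hp).continuousAt.continuousWithinAt)
      (fun p hp => (hg p (interior_subset hp)).hasDerivWithinAt)
      (fun p hp => hg' p (interior_subset hp))
  refine le_of_tendsto hlim ?_
  filter_upwards [Ioc_mem_nhdsGT hz.1] with t ht
  exact hmono ⟨ht.1, ht.2.trans_lt hz.2⟩ hz ht.2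

open Topology in
lemma linear_bounds_of_deriv_bounds {P P₁ : ℝ → ℝ} {a b s t : ℝ}
    (hP : ∀ z ∈ Ioo a b, HasDerivAt P (P₁ z) z) (hlim : Tendsto P (𝓝[>] a) (𝓝 0))
    (hst : ∀ z ∈ Ioo a b, s ≤ P₁ z ∧ P₁ z ≤ t) :
    ∀ z ∈ Ioo a b, s * (z - a) ≤ P z ∧ P z ≤ t * (z - a) := by
  have hlin : ∀ c : ℝ, Tendsto (fun z => c * (z - a)) (𝓝[>] a) (𝓝 0) := fun c => by
    have : ContinuousAt (fun z => c * (z - a)) a := by fun_prop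
    have h2 := this.tendsto
    simp only [sub_self, mul_zero] at h2
    exact h2.mono_left nhdsWithin_le_nhds
  have hd : ∀ c z : ℝ, HasDerivAt (fun z => c * (z - a)) c z := fun c z => by
    simpa using ((hasDerivAt_id z).sub_const a).const_mul c
  intro z hz
  constructor
  · have := nonneg_of_deriv_nonneg_of_tendsto_zero (g := fun z => P z - s * (z - a))
      (fun z hz => (hP z hz).sub (hd s z)) (fun z hz => by linarith [(hst z hz).1])
      (by simpa using hlim.sub (hlin s)) z hz
    linarith
  · have := nonneg_of_deriv_nonneg_of_tendsto_zero (g := fun z => t * (z - a) - P z)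
      (fun z hz => (hd t z).sub (hP z hz)) (fun z hz => by linarith [(hst z hz).2])
      (by simpa using (hlin t).sub hlim) z hz
    linarith

namespace IsPressureProfile

variable {m σ μ ρ A z₀ K hi : ℝ} {P P₁ P₂ : ℝ → ℝ}

lemma strictMonoOn (h : IsPressureProfile m σ μ ρ A z₀ K hi P P₁ P₂) :
    StrictMonoOn P (Ioi z₀) :=
  strictMonoOn_of_hasDerivWithinAt_pos (f' := P₁) (convex_Ioi z₀)
    (fun z hz => (h.hasDerivAt z hz).continuousAt.continuousWithinAt)
    (fun z hz => (h.hasDerivAt z (interior_subset hz)).hasDerivWithinAt)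
    (fun z hz => h.deriv_pos z (interior_subset hz))

lemma rpow_mul_second (h : IsPressureProfile m σ μ ρ A z₀ K hi P P₁ P₂) (hm : 0 < m) {z : ℝ}
    (hz : z ∈ Ioi z₀) : P z ^ σ * P₂ z = μ * (P z ^ (σ - 1) * P₁ z ^ 2)
      + (P z + ρ - (σ + 1) / 2 * (z * P₁ z)) / m := by
  have h1 := h.ode z hz
  refine mul_left_cancel₀ hm.ne' ?_
  have h3 : m * ((P z + ρ - (σ + 1) / 2 * (z * P₁ z)) / m)
      = P z + ρ - (σ + 1) / 2 * (z * P₁ z) := by field_simp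
  linear_combination h1 - h3

lemma deriv_rpow (h : IsPressureProfile m σ μ ρ A z₀ K hi P P₁ P₂) (a : ℝ) {z : ℝ}
    (hz : z ∈ Ioi z₀) : deriv (fun z => P z ^ (-a)) z = -(a * P z ^ (-a - 1) * P₁ z) := by
  rw [(hasDerivAt_rpow_pressure h.pos h.hasDerivAt (-a) z hz).deriv]
  ring

lemma deriv_deriv_rpow (h : IsPressureProfile m σ μ ρ A z₀ K hi P P₁ P₂) (a : ℝ) {z : ℝ}
    (hz : z ∈ Ioi z₀) : deriv (deriv fun z => P z ^ (-a)) z = -(a * P z ^ (-a - 1 - σ)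
      * (P z ^ σ * P₂ z - (a + 1) * (P z ^ (σ - 1) * P₁ z ^ 2))) := by
  have hp := h.pos z hz
  rw [(hasDerivAt_deriv_rpow_pressure isOpen_Ioi h.pos h.hasDerivAt h.hasDerivAt_deriv
    (-a) z hz).deriv]
  have e1 : P z ^ (-a - 2) = P z ^ (-a - 1 - σ) * P z ^ (σ - 1) := by
    rw [← Real.rpow_add hp]; congr 1; ring
  have e2 : P z ^ (-a - 1) = P z ^ (-a - 1 - σ) * P z ^ σ := by
    rw [← Real.rpow_add hp]; congr 1; ring
  rw [e1, e2]
  ring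

open Topology in
/-- Near `z₀` the second derivative of `P` is `o(P ^ (-σ))`: by the value of the slope of `P` at `z₀`,
the other terms of the equation cancel in the limit. The term with `P₁ ^ 2`, which is of lower order
because `1 < σ`, completes the expression found in `deriv_deriv_rpow`. -/
lemma tendsto_second (h : IsPressureProfile m σ μ ρ A z₀ K hi P P₁ P₂) (hm : 0 < m) (hσ : 1 < σ)
    (a : ℝ) : Tendsto (fun z => P z ^ σ * P₂ z - (a + 1) * (P z ^ (σ - 1) * P₁ z ^ 2))
      (𝓝[>] z₀) (𝓝 0) := by
  have hz₀ := h.z₀_pos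
  have hpw : Tendsto (fun z => P z ^ (σ - 1)) (𝓝[>] z₀) (𝓝 0) := by
    have := h.tendsto.rpow_const (p := σ - 1) (Or.inr (by linarith))
    rwa [Real.zero_rpow (by linarith)] at this
  have hz : Tendsto (fun z : ℝ => z) (𝓝[>] z₀) (𝓝 z₀) := tendsto_id.mono_left nhdsWithin_le_nhds
  have h1 := hpw.mul (h.tendsto_deriv.pow 2)
  have h2 := ((h1.const_mul μ).add (((h.tendsto.add_const ρ).sub
    ((hz.mul h.tendsto_deriv).const_mul ((σ + 1) / 2))).div_const m)).sub (h1.const_mul (a + 1))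
  have hσ1 : σ + 1 ≠ 0 := by linarith
  have e : μ * (0 * (2 * ρ / ((σ + 1) * z₀)) ^ 2)
      + (0 + ρ - (σ + 1) / 2 * (z₀ * (2 * ρ / ((σ + 1) * z₀)))) / m
      - (a + 1) * (0 * (2 * ρ / ((σ + 1) * z₀)) ^ 2) = 0 := by
    field_simp
    ring
  rw [e] at h2
  refine h2.congr' ?_
  filter_upwards [self_mem_nhdsWithin] with z hz
  rw [h.rpow_mul_second hm hz]

/-- Away from `z₀`, the derivatives of `P` have the order of magnitude of those of
`z ^ (2 / σ)`. -/
lemma exists_deriv_bounds (h : IsPressureProfile m σ μ ρ A z₀ K hi P P₁ P₂) (hm : 0 < m)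
    (hσ : 1 < σ) (hμ : 1 < μ) (hρ : 0 < ρ) (hA : 0 < A) {a z₁ : ℝ} (ha : 0 < a)
    (hz₁ : z₁ ∈ Ioi z₀) :
    ∃ L > 0, ∃ M > 0, ∀ z ≥ z₁, P z ^ (σ / 2) * P₁ z ≤ L * P z ∧
      |P z ^ σ * P₂ z - (a + 1) * (P z ^ (σ - 1) * P₁ z ^ 2)| ≤ M * P z := by
  have hP1 := h.pos z₁ hz₁
  have hhi := h.hi_pos
  have hK := h.K_pos
  obtain ⟨c, hc⟩ : ∃ c, c = 1 + (hi + ρ) / P z₁ := ⟨_, rfl⟩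
  have hc0 : 0 < c := by rw [hc]; positivity
  obtain ⟨L, hL⟩ : ∃ L, L = K * c / A := ⟨_, rfl⟩
  have hL0 : 0 < L := by rw [hL]; positivity
  obtain ⟨N, hN⟩ : ∃ N, N = (c + (σ + 1) / 2 * (K * c)) / m := ⟨_, rfl⟩
  have hN0 : 0 < N := by rw [hN]; positivity
  refine ⟨L, hL0, (μ + (a + 1)) * L ^ 2 + N, by positivity, fun z hz => ?_⟩
  have hz' : z ∈ Ioi z₀ := lt_of_lt_of_le hz₁ hz
  have hp := h.pos z hz'
  have hp₁ := h.deriv_pos z hz'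
  have hzpos : 0 < z := h.z₀_pos.trans hz'
  have hPP : P z₁ ≤ P z := h.strictMonoOn.monotoneOn hz₁ hz' hz
  have hcP : P z + hi + ρ ≤ c * P z := by
    have h1 : hi + ρ ≤ (hi + ρ) / P z₁ * P z := by
      rw [div_mul_eq_mul_div, le_div_iff₀ hP1]; gcongr
    rw [hc]; linarith
  have hzK : z * P₁ z ≤ K * c * P z := by
    have h1 := h.mul_deriv_le z hz'
    have h2 : K * (P z + hi) ≤ K * (c * P z) := by gcongr; linarith
    linarith
  have hP₁le : P z ^ (σ / 2) * P₁ z ≤ L * P z := by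
    rw [hL, div_mul_eq_mul_div, le_div_iff₀ hA]
    have h1 : A * P z ^ (σ / 2) * P₁ z ≤ z * P₁ z := by gcongr; exact h.le_self z hz'
    linarith
  refine ⟨hP₁le, ?_⟩
  have e2 : P z ^ (σ - 1) * P z = (P z ^ (σ / 2)) ^ 2 := by
    rw [← Real.rpow_add_one hp.ne', ← Real.rpow_natCast, ← Real.rpow_mul hp.le]
    congr 1
    push_cast; ring
  have hquad : P z ^ (σ - 1) * P₁ z ^ 2 ≤ L ^ 2 * P z := by
    have h2 : P z ^ (σ - 1) * P₁ z ^ 2 * P z ≤ L ^ 2 * P z * P z := by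
      calc _ = (P z ^ (σ / 2) * P₁ z) ^ 2 := by rw [mul_pow, ← e2]; ring
        _ ≤ (L * P z) ^ 2 := by gcongr
        _ = _ := by ring
    exact le_of_mul_le_mul_right h2 hp
  have hquad0 : 0 ≤ P z ^ (σ - 1) * P₁ z ^ 2 := by positivity
  have h2 : |(P z + ρ - (σ + 1) / 2 * (z * P₁ z)) / m| ≤ N * P z := by
    rw [abs_div, abs_of_pos hm, hN, div_mul_eq_mul_div _ m]
    refine div_le_div_of_nonneg_right ?_ hm.le
    have h3 : (σ + 1) / 2 * (z * P₁ z) ≤ (σ + 1) / 2 * (K * c * P z) := by gcongr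
    have h4 : 0 ≤ (σ + 1) / 2 * (z * P₁ z) := by positivity
    have h5 : 0 < c * P z := by positivity
    have h6 : 0 < (σ + 1) / 2 * (K * c * P z) := by positivity
    rw [abs_le]
    constructor <;> linarith
  have h3 : μ * (P z ^ (σ - 1) * P₁ z ^ 2) ≤ μ * (L ^ 2 * P z) := by gcongr
  have h4 : (a + 1) * (P z ^ (σ - 1) * P₁ z ^ 2) ≤ (a + 1) * (L ^ 2 * P z) := by gcongr
  have h5 : 0 ≤ μ * (P z ^ (σ - 1) * P₁ z ^ 2) := by positivity
  have h6 : 0 ≤ (a + 1) * (P z ^ (σ - 1) * P₁ z ^ 2) := by positivity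
  rw [abs_le] at h2
  rw [h.rpow_mul_second hm hz', abs_le]
  constructor <;> linarith [h2.1, h2.2]

open Topology in
/-- The blow-up rate of `φ = P ^ (-a)`, with `a = 1 / (β - 1)`, at `z₀`. -/
lemma blowup_bounds (h : IsPressureProfile m σ μ ρ A z₀ K hi P P₁ P₂) {a β C₀ k₀ K₀ : ℝ}
    (hβ : 1 < β) (ha : a = 1 / (β - 1)) (hk₀ : 0 < k₀) (hkC : k₀ < C₀) (hCK : C₀ < K₀)
    (hslope : 2 * ρ / ((σ + 1) * z₀) = C₀ ^ (1 - β)) :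
    ∃ z₁ > z₀, ∀ z ∈ Ioo z₀ z₁,
      k₀ / (z - z₀) ^ a ≤ P z ^ (-a) ∧ P z ^ (-a) ≤ K₀ / (z - z₀) ^ a ∧
      -(k₀ ^ (1 - β) / (β - 1)) * (P z ^ (-a)) ^ β < deriv (fun z => P z ^ (-a)) z ∧
      deriv (fun z => P z ^ (-a)) z < -(K₀ ^ (1 - β) / (β - 1)) * (P z ^ (-a)) ^ β := by
  have hβ1 : 0 < β - 1 := by linarith
  have ha0 : 0 < a := by rw [ha]; positivity
  have ha1 : a * (β - 1) = 1 := by rw [ha]; field_simp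
  have hC₀pos : 0 < C₀ := hk₀.trans hkC
  have hK₀ : 0 < K₀ := hC₀pos.trans hCK
  have hP₁lim := h.tendsto_deriv
  rw [hslope] at hP₁lim
  have hb1 : K₀ ^ (1 - β) < C₀ ^ (1 - β) :=
    Real.rpow_lt_rpow_of_neg hC₀pos hCK (by linarith)
  have hb2 : C₀ ^ (1 - β) < k₀ ^ (1 - β) :=
    Real.rpow_lt_rpow_of_neg hk₀ hkC (by linarith)
  obtain ⟨z₁, hz₁, hev⟩ := (mem_nhdsGT_iff_exists_Ioo_subset).1
    ((hP₁lim.eventually (lt_mem_nhds hb1)).and (hP₁lim.eventually (gt_mem_nhds hb2)))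
  have hlin := linear_bounds_of_deriv_bounds (fun z hz => h.hasDerivAt z (mem_Ioi.2 hz.1))
    h.tendsto (fun z hz => ⟨(hev hz).1.le, (hev hz).2.le⟩)
  refine ⟨z₁, hz₁, fun z hz => ?_⟩
  have hzz : 0 < z - z₀ := sub_pos.2 hz.1
  have hp := h.pos z hz.1
  have hpow : ∀ c : ℝ, 0 < c → (c ^ (1 - β) * (z - z₀)) ^ (-a) = c / (z - z₀) ^ a := by
    intro c hc
    rw [Real.mul_rpow (by positivity) hzz.le, ← Real.rpow_mul hc.le,
      show (1 - β) * -a = 1 by linear_combination ha1, Real.rpow_one, Real.rpow_neg hzz.le]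
    rfl
  have hg : 0 < a * P z ^ (-a - 1) := mul_pos ha0 (Real.rpow_pos_of_pos hp _)
  have hform : ∀ c : ℝ, -(c / (β - 1)) * (P z ^ (-a)) ^ β = -(a * P z ^ (-a - 1) * c) :=
    fun c => by
      rw [← Real.rpow_mul hp.le, show -a * β = -a - 1 by linear_combination -ha1, ha]
      ring
  refine ⟨?_, ?_, ?_, ?_⟩
  · rw [← hpow k₀ hk₀]
    exact Real.rpow_le_rpow_of_nonpos hp (hlin z hz).2 (by linarith)
  · rw [← hpow K₀ hK₀]
    exact Real.rpow_le_rpow_of_nonpos (by positivity) (hlin z hz).1 (by linarith)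
  · rw [hform, h.deriv_rpow a hz.1]
    exact neg_lt_neg (mul_lt_mul_of_pos_left (hev hz).2 hg)
  · rw [hform, h.deriv_rpow a hz.1]
    exact neg_lt_neg (mul_lt_mul_of_pos_left (hev hz).1 hg)

open Topology in
lemma second_deriv_small (h : IsPressureProfile m σ μ ρ A z₀ K hi P P₁ P₂) (hm : 0 < m)
    (hσ : 1 < σ) {a δ : ℝ} (ha : 0 < a) (hδ : 0 < δ) :
    ∃ z₁ > z₀, ∀ z ∈ Ioo z₀ z₁,
      |deriv (deriv fun z => P z ^ (-a)) z| ≤ δ * P z ^ (-a - 1 - σ) := by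
  obtain ⟨z₁, hz₁, hev⟩ := (mem_nhdsGT_iff_exists_Ioo_subset).1
    ((h.tendsto_second hm hσ a).abs.eventually
      (gt_mem_nhds (show |(0 : ℝ)| < δ / a by rw [abs_zero]; positivity)))
  refine ⟨z₁, hz₁, fun z hz => ?_⟩
  have hg : 0 < P z ^ (-a - 1 - σ) := Real.rpow_pos_of_pos (h.pos z hz.1) _
  rw [h.deriv_deriv_rpow a hz.1, abs_neg, abs_mul, abs_mul, abs_of_pos ha, abs_of_pos hg]
  have h1 := (lt_div_iff₀ ha).1 (hev hz)
  have h2 := mul_le_mul_of_nonneg_left h1.le hg.le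
  linarith

lemma tail_bounds (h : IsPressureProfile m σ μ ρ A z₀ K hi P P₁ P₂) (hA : 0 < A) {a q : ℝ}
    (ha : 0 < a) (hq : 0 < q) (hqσ : σ / 2 * q = a) (hσ : 0 < σ) :
    ∀ᶠ z in atTop, A ^ q / z ^ q ≤ P z ^ (-a) ∧
      P z ^ (-a) ≤ A ^ q * (1 + hi) ^ a / z ^ q := by
  have hhi := h.hi_pos
  filter_upwards [eventually_gt_atTop z₀, eventually_ge_atTop (A * (1 + hi) ^ (σ / 2))]
    with z hz hzbig
  have hp := h.pos z hz
  have hzpos : 0 < z := h.z₀_pos.trans hz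
  have hP1 : 1 ≤ P z := by
    by_contra! hlt
    have h1 : A * (P z + hi) ^ (σ / 2) < A * (1 + hi) ^ (σ / 2) := by gcongr
    linarith [h.self_le z hz]
  have hform : ∀ x : ℝ, 0 < x → (A * x ^ (σ / 2)) ^ q = A ^ q * x ^ a := fun x hx => by
    rw [Real.mul_rpow hA.le (by positivity), ← Real.rpow_mul hx.le, hqσ]
  have hPa : 0 < P z ^ a := Real.rpow_pos_of_pos hp a
  have hzq : 0 < z ^ q := Real.rpow_pos_of_pos hzpos q
  have hAq : 0 < A ^ q := Real.rpow_pos_of_pos hA q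
  rw [Real.rpow_neg hp.le]
  constructor
  · have h1 : A ^ q * P z ^ a ≤ z ^ q := by
      rw [← hform _ hp]
      exact Real.rpow_le_rpow (by positivity) (h.le_self z hz) hq.le
    rw [div_le_iff₀ hzq, inv_mul_eq_div, le_div_iff₀ hPa]
    exact h1
  · have h1 : z ^ q ≤ A ^ q * (P z + hi) ^ a := by
      rw [← hform _ (by positivity)]
      exact Real.rpow_le_rpow hzpos.le (h.self_le z hz) hq.le
    have h2 : (P z + hi) ^ a ≤ (1 + hi) ^ a * P z ^ a := by
      rw [← Real.mul_rpow (by positivity) hp.le]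
      exact Real.rpow_le_rpow (by positivity) (by nlinarith) ha.le
    have h3 := mul_le_mul_of_nonneg_left h2 hAq.le
    rw [le_div_iff₀ hzq, inv_mul_eq_div, div_le_iff₀ hPa]
    linarith

lemma deriv_bounds (h : IsPressureProfile m σ μ ρ A z₀ K hi P P₁ P₂) (hm : 0 < m)
    (hσ : 1 < σ) (hμ : 1 < μ) (hρ : 0 < ρ) (hA : 0 < A) {a z₁ : ℝ} (ha : 0 < a)
    (hz₁ : z₁ ∈ Ioi z₀) :
    ∃ K' > 0, ∃ K'' > 0, ∀ z ≥ z₁,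
      -K' * P z ^ (-a - σ / 2) ≤ deriv (fun z => P z ^ (-a)) z ∧
      deriv (fun z => P z ^ (-a)) z < 0 ∧
      |deriv (deriv fun z => P z ^ (-a)) z| ≤ K'' * P z ^ (-a - σ) := by
  obtain ⟨L, hL, M, hM, hLM⟩ := h.exists_deriv_bounds hm hσ hμ hρ hA ha hz₁
  refine ⟨a * L, by positivity, a * M, by positivity, fun z hz => ?_⟩
  have hz' : z ∈ Ioi z₀ := lt_of_lt_of_le hz₁ hz
  have hp := h.pos z hz'
  have hg : 0 < a * P z ^ (-a - 1 - σ / 2) := mul_pos ha (Real.rpow_pos_of_pos hp _)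
  have hg' : 0 < a * P z ^ (-a - 1 - σ) := mul_pos ha (Real.rpow_pos_of_pos hp _)
  obtain ⟨h1, h2⟩ := hLM z hz
  have e1 : P z ^ (-a - σ / 2) = P z ^ (-a - 1 - σ / 2) * P z := by
    rw [← Real.rpow_add_one hp.ne']; congr 1; ring
  have e2 : P z ^ (-a - 1) = P z ^ (-a - 1 - σ / 2) * P z ^ (σ / 2) := by
    rw [← Real.rpow_add hp]; congr 1; ring
  have e3 : P z ^ (-a - σ) = P z ^ (-a - 1 - σ) * P z := by
    rw [← Real.rpow_add_one hp.ne']; congr 1; ring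
  refine ⟨?_, ?_, ?_⟩
  · rw [h.deriv_rpow a hz', e1, e2]
    have := mul_le_mul_of_nonneg_left h1 hg.le
    linarith
  · rw [h.deriv_rpow a hz']
    exact neg_lt_zero.2 (mul_pos (mul_pos ha (Real.rpow_pos_of_pos hp _)) (h.deriv_pos z hz'))
  · rw [h.deriv_deriv_rpow a hz', e3, abs_neg, abs_mul, abs_of_pos hg']
    have := mul_le_mul_of_nonneg_left h2 hg'.le
    linarith

end IsPressureProfile

theorem mainTheorem2 (m α β r : ℝ) (hm0 : 0 < m) (hm1 : m < 1) (hα : 1 / (1 - m) < α)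
    (hβ : 1 < β) (hr : 0 < r) (hlow : m + 2 / α ≤ β) (hup : β < 2 - m) :
    ∃ z₀ C₀ C_inf : ℝ, 0 < z₀ ∧ 0 < C₀ ∧ 0 < C_inf ∧
      C₀ = (z₀ * (β - m) / (2 * r * (β - 1) ^ 2)) ^ (1 / (β - 1)) ∧
      IsProfileSolutionOn m β 0 (fun z => C_inf / z ^ (2 / (1 - m))) (Ioi 0) ∧
      ∃ ε : ℝ → ℝ, (∀ δ > 0, 0 < ε δ) ∧
      ∀ k₀ K₀ k_inf : ℝ, 0 < k₀ → k₀ < C₀ → C₀ < K₀ → 0 < k_inf → k_inf < C_inf →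
      ∃ K_inf > C_inf, ∃ φ : ℝ → ℝ,
        StrictAntiOn φ (Ioi z₀) ∧
        IsProfileSolutionOn m β r φ (Ioi z₀) ∧
        (∃ z₁ > z₀, ∀ z ∈ Ioo z₀ z₁,
          k₀ / (z - z₀) ^ (1 / (β - 1)) ≤ φ z ∧
          φ z ≤ K₀ / (z - z₀) ^ (1 / (β - 1)) ∧
          -(k₀ ^ (1 - β) / (β - 1)) * φ z ^ β < deriv φ z ∧
          deriv φ z < -(K₀ ^ (1 - β) / (β - 1)) * φ z ^ β) ∧
        (∀ δ > 0, max (K₀ - C₀) (C₀ - k₀) < ε δ →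
          ∃ z₁ > z₀, ∀ z ∈ Ioo z₀ z₁, |deriv (deriv φ) z| ≤ δ * φ z ^ (β + 1 - m)) ∧
        (∀ᶠ z in atTop,
          k_inf / z ^ (2 / (1 - m)) ≤ φ z ∧ φ z ≤ K_inf / z ^ (2 / (1 - m))) ∧
        ∀ z₁ > z₀, ∃ K' > 0, ∃ K'' > 0, ∀ z ≥ z₁,
          -K' * φ z ^ ((3 - m) / 2) ≤ deriv φ z ∧ deriv φ z < 0 ∧
          |deriv (deriv φ) z| ≤ K'' * φ z ^ (2 - m) := by
  have h1m : 0 < 1 - m := by linarith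
  have hβ1 : 0 < β - 1 := by linarith
  have hβm : 0 < β - m := by linarith
  obtain ⟨a, ha⟩ : ∃ a, a = 1 / (β - 1) := ⟨_, rfl⟩
  have ha0 : 0 < a := by rw [ha]; positivity
  have ha1 : a * (β - 1) = 1 := by rw [ha]; field_simp
  obtain ⟨σ, hσ⟩ : ∃ σ, σ = a * (1 - m) := ⟨_, rfl⟩
  have hσ1 : 1 < σ := by rw [hσ]; nlinarith
  have hσ0 : 0 < σ := by linarith
  obtain ⟨μ, hμ⟩ : ∃ μ, μ = m * a + 1 := ⟨_, rfl⟩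
  have hμ1 : 1 < μ := by rw [hμ]; nlinarith [mul_pos hm0 ha0]
  obtain ⟨ρ, hρ⟩ : ∃ ρ, ρ = r * (β - 1) := ⟨_, rfl⟩
  have hρ0 : 0 < ρ := by rw [hρ]; positivity
  obtain ⟨A, hAdef⟩ : ∃ A, A = Real.sqrt (2 * m * (1 + m) / (1 - m)) := ⟨_, rfl⟩
  have hA0 : 0 < A := by rw [hAdef]; positivity
  have hA2 : A ^ 2 = 2 * m * (1 + m) / (1 - m) := by rw [hAdef]; exact Real.sq_sqrt (by positivity)
  have hA : A ^ 2 = 2 * m * (σ + 2 * μ - 2) / σ := by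
    rw [hA2, hμ, hσ]; field_simp; ring
  obtain ⟨z₀, K, hi, P, P₁, P₂, h⟩ := exists_isPressureProfile hm0 hσ1 hμ1 hρ0 hA0 hA
  have hz₀ := h.z₀_pos
  -- the slope of `P` at `z₀`, expressed through `C₀`
  obtain ⟨C₀, hC₀⟩ : ∃ C₀, C₀ = (z₀ * (β - m) / (2 * r * (β - 1) ^ 2)) ^ (1 / (β - 1)) := ⟨_, rfl⟩
  have hC₀pos : 0 < C₀ := by rw [hC₀]; positivity
  have hslope : 2 * ρ / ((σ + 1) * z₀) = C₀ ^ (1 - β) := by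
    rw [hC₀, ← Real.rpow_mul (by positivity), show 1 / (β - 1) * (1 - β) = -1 by
      rw [← ha]; linear_combination -ha1, Real.rpow_neg_one, inv_div]
    have : σ + 1 = (β - m) / (β - 1) := by rw [hσ, ha]; field_simp; ring
    rw [this, hρ]
    field_simp
  obtain ⟨q, hq⟩ : ∃ q, q = 2 / (1 - m) := ⟨_, rfl⟩
  have hq0 : 0 < q := by rw [hq]; positivity
  have hqσ : σ / 2 * q = a := by rw [hq, hσ]; field_simp
  have hCinf0 : 0 < A ^ q := by positivity
  have hCm : (A ^ q) ^ (1 - m) = 2 * m * (1 + m) / (1 - m) := by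
    rw [← hA2, ← Real.rpow_mul hA0.le, hq, div_mul_cancel₀ _ h1m.ne']
    norm_cast
  have hφpow : ∀ z ∈ Ioi z₀, ∀ e : ℝ, (P z ^ (-a)) ^ e = P z ^ (-a * e) := fun z hz e =>
    (Real.rpow_mul (h.pos z hz).le _ _).symm
  -- the same `φ` serves all `k₀`, `K₀`, `k_inf`, and the second derivative is small near `z₀`
  -- whatever `δ` is, so that any positive function `ε` will do
  refine ⟨z₀, C₀, A ^ q, hz₀, hC₀pos, hCinf0, hC₀,
    isProfileSolutionOn_power hm0 hm1 hβ hCinf0 hCm, fun _ => 1, fun _ _ => one_pos, ?_⟩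
  intro k₀ K₀ k_inf hk₀ hkC hCK hk_inf hkinfC
  refine ⟨A ^ q * (1 + hi) ^ a, ?_, fun z => P z ^ (-a), ?_, ?_, ?_, ?_, ?_, ?_⟩
  · exact lt_mul_of_one_lt_right hCinf0 (Real.one_lt_rpow (by linarith [h.hi_pos]) ha0)
  · intro y hy z hz hyz
    exact Real.rpow_lt_rpow_of_neg (h.pos y hy) (h.strictMonoOn hy hz hyz) (neg_lt_zero.2 ha0)
  · exact isProfileSolutionOn_rpow_pressure hm0 ha1 hσ hμ isOpen_Ioi h.pos h.hasDerivAt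
      h.hasDerivAt_deriv (fun z hz => by rw [← hρ]; exact h.ode z hz)
  · rw [← ha]
    exact h.blowup_bounds hβ ha hk₀ hkC hCK hslope
  · intro δ hδ _
    obtain ⟨z₁, hz₁, hz₁'⟩ := h.second_deriv_small hm0 hσ1 ha0 hδ
    refine ⟨z₁, hz₁, fun z hz => ?_⟩
    rw [hφpow z hz.1, show -a * (β + 1 - m) = -a - 1 - σ by rw [hσ]; linear_combination -ha1]
    exact hz₁' z hz
  · rw [← hq]
    filter_upwards [h.tail_bounds hA0 ha0 hq0 hqσ hσ0, eventually_gt_atTop 0] with z hz hz0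
    exact ⟨(div_le_div_of_nonneg_right hkinfC.le (by positivity)).trans hz.1, hz.2⟩
  · intro z₁ hz₁
    obtain ⟨K', hK', K'', hK'', hb⟩ := h.deriv_bounds hm0 hσ1 hμ1 hρ0 hA0 ha0 hz₁
    refine ⟨K', hK', K'', hK'', fun z hz => ?_⟩
    have hz' : z ∈ Ioi z₀ := lt_of_lt_of_le hz₁ hz
    rw [hφpow z hz', hφpow z hz', show -a * ((3 - m) / 2) = -a - σ / 2 by rw [hσ]; ring,
      show -a * (2 - m) = -a - σ by rw [hσ]; ring]
    exact hb z hz
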